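/- Let $\Theta$ be a compact metric space, $T:\Theta\to\Theta$ a homeomorphism and $\mu$ a $T$-ergodic Borel probability measure on $\Theta$. Let $m\ge 1$, $J=\begin{pmatrix}0&I_m\\-I_m&0\end{pmatrix}$ and $\mathrm{HSp}(2m,\mathbb C)=\{M\in \mathrm{GL}(2m,\mathbb C): M^*JM=J\}$. This group acts on the Lagrangian Grassmannian, whose points are the classes $\Lambda=\begin{bmatrix}X\\Y\end{bmatrix}$ (up to right multiplication by $\mathrm{GL}(m,\mathbb C)$) of $2m\times m$ matrices of rank $m$ with $X^*Y=Y^*X$. The map $\Lambda\mapsto W_\Lambda=(X+iY)(X-iY)^{-1}$ is a bijection from the Lagrangian Grassmannian onto $\mathbf U(m)$, so each $M\in\mathrm{HSp}(2m,\mathbb C)$ acts on $\mathbf U(m)$ by $W_\Lambda\mapsto W_{M\Lambda}$. Let $A:\Theta\to\mathrm{HSp}(2m,\mathbb C)$ be continuous and homotopic, through continuous maps $\Theta\to\mathrm{HSp}(2m,\mathbb C)$, to the constant map $I_{2m}$, and let $(T,A)$ denote the map $(\theta,W_\Lambda)\mapsto(T\theta,W_{A(\theta)\Lambda})$ of $\Theta\times\mathbf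 U(m)$. A lift of $(T,A)$ is a continuous map $\tilde F:\Theta\times\mathbb R\times\mathbf{SU}(m)\to\Theta\times\mathbb R\times\mathbf{SU}(m)$ with $P\circ\tilde F=(T,A)\circ P$, where $P(\theta,x,S)=(\theta,e^{2\pi i x}S)$. Let $p_2$ be the projection of $\Theta\times\mathbb R\times\mathbf{SU}(m)$ to $\mathbb R$, and $\mu(C(\Theta,\mathbb Z))=\{\int p\,d\mu: p\in C(\Theta,\mathbb Z)\}$, a subgroup of $\mathbb R$. Then: 1. A lift of $(T,A)$ exists. 2. For every lift $\tilde F$ the formula $f(\theta,e^{2\pi i x}S)=m\,\bigl(p_2\tilde F(\theta,x,S)-x\bigr)$ gives a well-defined continuous function $f=f_{\tilde F}:\Theta\times\mathbf U(m)\to\mathbb R$. If for some $(\theta,W)\in\Theta\times\mathbf U(m)$ the limit $$\lim_{n\to\infty}\frac1n\sum_{k=0}^{n-1}f\bigl((T,A)^k(\theta,W)\bigr)$$ exists in $\mathbb R$, then it exists and has the same value at $(\theta,W')$ for every $W'\in\mathbf U(m)$. 3. For any two lifts $\tilde F,\tilde F'$ there is $p\in C(\Theta,\mathbb Z)$ with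 $f_{\tilde F}(\theta,W)=f_{\tilde F'}(\theta,W)+p(\theta)$ for all $(\theta,W)\in\Theta\times\mathbf U(m)$. 4. There is exactly one class $\mathrm{rot}_f(T,A)\in\mathbb R/\mu(C(\Theta,\mathbb Z))$ such that for every lift $\tilde F$ there is a representative $\varrho\in\mathbb R$ of this class with the following two properties: for $\mu$-a.e. $\theta\in\Theta$ the limit above, for $f=f_{\tilde F}$, exists and equals $\varrho$ for all $W\in\mathbf U(m)$; and for every $(T,A)$-invariant Borel probability measure $\nu$ on $\Theta\times\mathbf U(m)$ that projects to $\mu$, the function $f_{\tilde F}$ is $\nu$-integrable and $\int f_{\tilde F}\,d\nu=\varrho$. -/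

import Mathlib

open Matrix Filter Topology MeasureTheory

noncomputable section

namespace FiberedRotation

/-- The unitary group `U(m)`. -/
abbrev U (m : ℕ) := Matrix.unitaryGroup (Fin m) ℂ

/-- The special unitary group `SU(m)`. -/
abbrev SU (m : ℕ) := Matrix.specialUnitaryGroup (Fin m) ℂ

/-- `U(m)` carries its Borel sigma-algebra. -/
instance instMeasurableSpaceU (m : ℕ) : MeasurableSpace (U m) := borel _

instance instBorelSpaceU (m : ℕ) : BorelSpace (U m) := ⟨rfl⟩

/-- The `2m × 2m` matrix `J` with blocks `0, I, -I, 0`. -/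
def J (m : ℕ) : Matrix (Fin m ⊕ Fin m) (Fin m ⊕ Fin m) ℂ := Matrix.fromBlocks 0 1 (-1) 0

/-- The Hermitian symplectic group `HSp(2m, ℂ) = {M ∈ GL(2m, ℂ) : M* J M = J}`. -/
def HSp (m : ℕ) : Subgroup (GL (Fin m ⊕ Fin m) ℂ) where
  carrier := {M | (M : Matrix (Fin m ⊕ Fin m) (Fin m ⊕ Fin m) ℂ)ᴴ * J m * M.1 = J m}
  one_mem' := by simp
  mul_mem' := by
    intro M N hM hN
    simp only [Set.mem_ofPred_eq, Units.val_mul, Matrix.conjTranspose_mul] at *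
    calc N.1ᴴ * M.1ᴴ * J m * (M.1 * N.1) = N.1ᴴ * (M.1ᴴ * J m * M.1) * N.1 := by
          simp only [Matrix.mul_assoc]
      _ = J m := by rw [hM, hN]
  inv_mem' := by
    intro M hM
    simp only [Set.mem_ofPred_eq] at *
    have h1 : M.1 * (M⁻¹).1 = 1 := by rw [← Units.val_mul, mul_inv_cancel, Units.val_one]
    have h2 : (M⁻¹).1ᴴ * M.1ᴴ = 1 := by
      rw [← Matrix.conjTranspose_mul, h1, Matrix.conjTranspose_one]
    calc (M⁻¹).1ᴴ * J m * (M⁻¹).1 = (M⁻¹).1ᴴ * (M.1ᴴ * J m * M.1) * (M⁻¹).1 := by rw [hM]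
      _ = ((M⁻¹).1ᴴ * M.1ᴴ) * J m * (M.1 * (M⁻¹).1) := by simp only [Matrix.mul_assoc]
      _ = J m := by rw [h1, h2]; simp

/-- A Lagrangian frame: an injective map `ℂ^m → ℂ^{2m}` with blocks `X, Y` such that
`X* Y = Y* X`. -/
structure LagFrame (m : ℕ) where
  X : Matrix (Fin m) (Fin m) ℂ
  Y : Matrix (Fin m) (Fin m) ℂ
  isotropic : Xᴴ * Y = Yᴴ * X
  full_rank : (Matrix.fromRows X Y).rank = m

/-- Two frames are equivalent (span the same Lagrangian subspace) if they differ by a right factor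
in `GL(m, ℂ)`. -/
instance LagFrame.setoid (m : ℕ) : Setoid (LagFrame m) where
  r L L' := ∃ R : GL (Fin m) ℂ, L.X = L'.X * R.1 ∧ L.Y = L'.Y * R.1
  iseqv := by
    refine ⟨fun L => ⟨1, by simp⟩, ?_, ?_⟩
    · rintro L L' ⟨R, hX, hY⟩
      have h : R.1 * (R⁻¹).1 = 1 := by rw [← Units.val_mul, mul_inv_cancel, Units.val_one]
      exact ⟨R⁻¹, by rw [hX, Matrix.mul_assoc, h, Matrix.mul_one],
        by rw [hY, Matrix.mul_assoc, h, Matrix.mul_one]⟩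
    · rintro L L' L'' ⟨R, hX, hY⟩ ⟨R', hX', hY'⟩
      exact ⟨R' * R, by rw [hX, hX', Units.val_mul, Matrix.mul_assoc],
        by rw [hY, hY', Units.val_mul, Matrix.mul_assoc]⟩

/-- The Lagrangian Grassmannian `Lag(ℂ^{2m}, ω_m)`. -/
abbrev Lag (m : ℕ) := Quotient (LagFrame.setoid m)

theorem fromRows_eq_mul {m : ℕ} (M : Matrix (Fin m ⊕ Fin m) (Fin m ⊕ Fin m) ℂ)
    (X Y : Matrix (Fin m) (Fin m) ℂ) :
    Matrix.fromRows (M.toBlocks₁₁ * X + M.toBlocks₁₂ * Y) (M.toBlocks₂₁ * X + M.toBlocks₂₂ * Y)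
      = M * Matrix.fromRows X Y := by
  conv_rhs => rw [← Matrix.fromBlocks_toBlocks M, Matrix.fromBlocks_mul_fromRows]

theorem fromRows_conjTranspose_J_mul {m : ℕ} (X Y : Matrix (Fin m) (Fin m) ℂ) :
    (Matrix.fromRows X Y)ᴴ * J m * Matrix.fromRows X Y = Xᴴ * Y - Yᴴ * X := by
  rw [Matrix.mul_assoc, J, Matrix.fromBlocks_mul_fromRows, Matrix.conjTranspose_fromRows_eq_fromCols_conjTranspose,
    Matrix.fromCols_mul_fromRows]
  simp [sub_eq_add_neg]

/-- The image `M L` of a Lagrangian frame `L` under `M ∈ HSp(2m, ℂ)`. -/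
def LagFrame.map {m : ℕ} (M : HSp m) (L : LagFrame m) : LagFrame m where
  X := M.1.1.toBlocks₁₁ * L.X + M.1.1.toBlocks₁₂ * L.Y
  Y := M.1.1.toBlocks₂₁ * L.X + M.1.1.toBlocks₂₂ * L.Y
  isotropic := by
    have hM : M.1.1ᴴ * J m * M.1.1 = J m := M.2
    rw [← sub_eq_zero, ← fromRows_conjTranspose_J_mul, fromRows_eq_mul,
      Matrix.conjTranspose_mul]
    calc _ = (Matrix.fromRows L.X L.Y)ᴴ * (M.1.1ᴴ * J m * M.1.1) * Matrix.fromRows L.X L.Y := by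
          simp only [Matrix.mul_assoc]
      _ = 0 := by rw [hM, fromRows_conjTranspose_J_mul, L.isotropic, sub_self]
  full_rank := by
    rw [fromRows_eq_mul, Matrix.rank_mul_eq_right_of_isUnit_det, L.full_rank]
    exact (Matrix.isUnit_iff_isUnit_det _).1 M.1.isUnit

/-- The action `Λ ↦ M Λ` of `HSp(2m, ℂ)` on the Lagrangian Grassmannian. -/
def Lag.map {m : ℕ} (M : HSp m) : Lag m → Lag m :=
  Quotient.map (LagFrame.map M) (by
    rintro L L' ⟨R, hX, hY⟩
    exact ⟨R, by simp only [LagFrame.map, hX, hY, Matrix.add_mul, Matrix.mul_assoc],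
      by simp only [LagFrame.map, hX, hY, Matrix.add_mul, Matrix.mul_assoc]⟩)

theorem I_smul_I_smul {m : ℕ} (Z : Matrix (Fin m) (Fin m) ℂ) :
    Complex.I • Complex.I • Z = -Z := by
  rw [smul_smul, Complex.I_mul_I, neg_one_smul]

theorem LagFrame.conjTranspose_sub_mul {m : ℕ} (L : LagFrame m) :
    (L.X - Complex.I • L.Y)ᴴ * (L.X - Complex.I • L.Y) = L.Xᴴ * L.X + L.Yᴴ * L.Y := by
  simp only [Matrix.conjTranspose_sub, Matrix.conjTranspose_smul, Matrix.sub_mul, Matrix.mul_sub,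
    Matrix.smul_mul, Matrix.mul_smul, L.isotropic, Complex.star_def, Complex.conj_I, neg_smul,
    Matrix.neg_mul, smul_add, smul_sub, smul_neg, I_smul_I_smul]
  abel

theorem LagFrame.conjTranspose_add_mul {m : ℕ} (L : LagFrame m) :
    (L.X + Complex.I • L.Y)ᴴ * (L.X + Complex.I • L.Y) = L.Xᴴ * L.X + L.Yᴴ * L.Y := by
  simp only [Matrix.conjTranspose_add, Matrix.conjTranspose_smul, Matrix.add_mul, Matrix.mul_add,
    Matrix.smul_mul, Matrix.mul_smul, L.isotropic, Complex.star_def, Complex.conj_I, neg_smul,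
    Matrix.neg_mul, smul_add, smul_sub, smul_neg, I_smul_I_smul]
  abel

open scoped ComplexOrder in
theorem LagFrame.isUnit_det {m : ℕ} (L : LagFrame m) : IsUnit (L.X - Complex.I • L.Y).det := by
  have h : (L.X - Complex.I • L.Y).rank = m := by
    rw [← Matrix.rank_conjTranspose_mul_self, L.conjTranspose_sub_mul]
    have h := L.full_rank
    rwa [← Matrix.rank_conjTranspose_mul_self,
      Matrix.conjTranspose_fromRows_eq_fromCols_conjTranspose,
      Matrix.fromCols_mul_fromRows] at h
  rw [← Matrix.isUnit_iff_isUnit_det, ← Matrix.linearIndependent_cols_iff_isUnit,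
    linearIndependent_iff_card_eq_finrank_span, Set.finrank, ← Matrix.rank_eq_finrank_span_cols, h,
    Fintype.card_fin]

/-- The unitary matrix `W_Λ = (X + iY)(X - iY)⁻¹` of a Lagrangian frame. -/
def LagFrame.toU {m : ℕ} (L : LagFrame m) : U m :=
  ⟨(L.X + Complex.I • L.Y) * (L.X - Complex.I • L.Y)⁻¹, by
    rw [Matrix.mem_unitaryGroup_iff', Matrix.star_eq_conjTranspose, Matrix.conjTranspose_mul]
    set P := L.X + Complex.I • L.Y with hP
    set Q := L.X - Complex.I • L.Y with hQ
    have hPQ : Pᴴ * P = Qᴴ * Q := by rw [L.conjTranspose_add_mul, L.conjTranspose_sub_mul]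
    have h1 : Q * Q⁻¹ = 1 := Matrix.mul_nonsing_inv _ L.isUnit_det
    calc (Q⁻¹)ᴴ * Pᴴ * (P * Q⁻¹) = (Q⁻¹)ᴴ * (Pᴴ * P) * Q⁻¹ := by simp only [Matrix.mul_assoc]
      _ = (Q * Q⁻¹)ᴴ * (Q * Q⁻¹) := by
          rw [hPQ, Matrix.conjTranspose_mul]; simp only [Matrix.mul_assoc]
      _ = 1 := by rw [h1]; simp⟩

/-- The map `Λ ↦ W_Λ` on the Lagrangian Grassmannian. -/
def Lag.toU {m : ℕ} : Lag m → U m :=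
  Quotient.lift LagFrame.toU (by
    rintro L L' ⟨R, hX, hY⟩
    apply Subtype.ext
    have hR : IsUnit R.1.det := (Matrix.isUnit_iff_isUnit_det _).1 R.isUnit
    simp only [LagFrame.toU, hX, hY, ← Matrix.smul_mul, ← Matrix.add_mul, ← Matrix.sub_mul]
    rw [Matrix.mul_inv_rev, Matrix.mul_assoc, ← Matrix.mul_assoc R.1, Matrix.mul_nonsing_inv _ hR,
      Matrix.one_mul])

open scoped ComplexOrder in
/-- The Lagrangian frame `(W + 1, i(1 - W))`, whose unitary matrix is `W`. -/
def frameOfU {m : ℕ} (W : U m) : LagFrame m where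
  X := W.1 + 1
  Y := Complex.I • (1 - W.1)
  isotropic := by
    have h : W.1ᴴ * W.1 = 1 := Matrix.mem_unitaryGroup_iff'.1 W.2
    simp only [Matrix.conjTranspose_add, Matrix.conjTranspose_smul, Matrix.conjTranspose_sub,
      Matrix.add_mul, Matrix.mul_add, Matrix.sub_mul, Matrix.mul_sub, Matrix.smul_mul,
      Matrix.mul_smul, h, Matrix.conjTranspose_one, Matrix.mul_one, Matrix.one_mul,
      Complex.star_def, Complex.conj_I]
    module
  full_rank := by
    have h : W.1ᴴ * W.1 = 1 := Matrix.mem_unitaryGroup_iff'.1 W.2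
    have h4 : (Matrix.fromRows (W.1 + 1) (Complex.I • (1 - W.1)))ᴴ *
        Matrix.fromRows (W.1 + 1) (Complex.I • (1 - W.1)) = (4 : ℂ) • 1 := by
      rw [Matrix.conjTranspose_fromRows_eq_fromCols_conjTranspose, Matrix.fromCols_mul_fromRows]
      simp only [Matrix.conjTranspose_add, Matrix.conjTranspose_smul, Matrix.conjTranspose_sub,
        Matrix.add_mul, Matrix.mul_add, Matrix.sub_mul, Matrix.mul_sub, Matrix.smul_mul,
        Matrix.mul_smul, h, Matrix.conjTranspose_one, Matrix.mul_one, Matrix.one_mul,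
        Complex.star_def, Complex.conj_I, neg_smul, Matrix.neg_mul, smul_neg, I_smul_I_smul, smul_sub]
      module
    rw [← Matrix.rank_conjTranspose_mul_self, h4, Matrix.rank_of_isUnit]
    · simp
    · rw [Matrix.isUnit_iff_isUnit_det]
      simp

theorem frameOfU_add {m : ℕ} (W : U m) :
    (frameOfU W).X + Complex.I • (frameOfU W).Y = (2 : ℂ) • W.1 := by
  simp only [frameOfU, smul_smul, Complex.I_mul_I]
  module

theorem frameOfU_sub {m : ℕ} (W : U m) :
    (frameOfU W).X - Complex.I • (frameOfU W).Y = (2 : ℂ) • (1 : Matrix (Fin m) (Fin m) ℂ) := by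
  simp only [frameOfU, smul_smul, Complex.I_mul_I]
  module

/-- The identification `Λ ↦ W_Λ` of `Lag(ℂ^{2m}, ω_m)` with `U(m)`. -/
def cayley (m : ℕ) : Lag m ≃ U m where
  toFun := Lag.toU
  invFun W := ⟦frameOfU W⟧
  left_inv := by
    intro Λ
    induction Λ using Quotient.inductionOn with
    | h L =>
      apply Quotient.sound
      have hu := L.isUnit_det
      have h1 := Matrix.mul_nonsing_inv _ hu
      have h2 := Matrix.nonsing_inv_mul _ hu
      set Q := L.X - Complex.I • L.Y with hQ
      refine ⟨⟨(2 : ℂ) • Q⁻¹, (1 / 2 : ℂ) • Q, by simp [h2], by simp [h1]⟩, ?_, ?_⟩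
      · change (L.X + Complex.I • L.Y) * Q⁻¹ + 1 = L.X * ((2 : ℂ) • Q⁻¹)
        rw [← h1, ← Matrix.add_mul, Matrix.mul_smul, ← Matrix.smul_mul]
        congr 1
        rw [hQ]
        module
      · change Complex.I • (1 - (L.X + Complex.I • L.Y) * Q⁻¹) = L.Y * ((2 : ℂ) • Q⁻¹)
        rw [← h1, ← Matrix.sub_mul, Matrix.mul_smul, ← Matrix.smul_mul, ← Matrix.smul_mul]
        congr 1
        rw [hQ]
        have : Complex.I • (L.X - Complex.I • L.Y - (L.X + Complex.I • L.Y))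
            = (-2 * (Complex.I * Complex.I)) • L.Y := by module
        rw [this, Complex.I_mul_I]
        module
  right_inv := by
    intro W
    apply Subtype.ext
    change ((frameOfU W).X + Complex.I • (frameOfU W).Y) *
      ((frameOfU W).X - Complex.I • (frameOfU W).Y)⁻¹ = W.1
    have h : ((2 : ℂ) • (1 : Matrix (Fin m) (Fin m) ℂ))⁻¹ = (1 / 2 : ℂ) • 1 :=
      Matrix.inv_eq_right_inv (by simp)
    rw [frameOfU_add, frameOfU_sub, h]
    simp

/-- The action of `HSp(2m, ℂ)` on `U(m)`: `W_Λ ↦ W_{M Λ}`. -/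
def actU {m : ℕ} (M : HSp m) (W : U m) : U m := cayley m (Lag.map M ((cayley m).symm W))

variable {Θ : Type*}

/-- The cocycle `(T, A) : (θ, W_Λ) ↦ (T θ, W_{A(θ) Λ})` on `Θ × U(m)`. -/
def cocycle {m : ℕ} (T : Θ → Θ) (A : Θ → HSp m) (q : Θ × U m) : Θ × U m :=
  (T q.1, actU (A q.1) q.2)

/-- The covering `ℝ × SU(m) → U(m)`, `(x, S) ↦ exp(2πix) S`. -/
def cover {m : ℕ} (p : ℝ × SU m) : U m :=
  ⟨Complex.exp (2 * Real.pi * Complex.I * p.1) • p.2.1, by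
    have h : p.2.1ᴴ * p.2.1 = 1 :=
      Matrix.mem_unitaryGroup_iff'.1 (Matrix.mem_specialUnitaryGroup_iff.1 p.2.2).1
    rw [Matrix.mem_unitaryGroup_iff', Matrix.star_eq_conjTranspose, Matrix.conjTranspose_smul,
      Matrix.smul_mul, Matrix.mul_smul, smul_smul, h]
    have : star (Complex.exp (2 * Real.pi * Complex.I * p.1)) *
        Complex.exp (2 * Real.pi * Complex.I * p.1) = 1 := by
      rw [Complex.star_def, ← Complex.exp_conj, ← Complex.exp_add]
      simp [Complex.conj_ofNat]
    rw [this, one_smul]⟩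

theorem cover_surjective (m : ℕ) : Function.Surjective (cover (m := m)) := by
  intro W
  have hW : W.1 ∈ Matrix.unitaryGroup (Fin m) ℂ := W.2
  obtain ⟨x, hx⟩ : ∃ x : ℝ, Complex.exp (2 * Real.pi * Complex.I * x) ^ m = W.1.det := by
    rcases Nat.eq_zero_or_pos m with rfl | hm
    · exact ⟨0, by simp⟩
    · have hn : ‖W.1.det‖ = 1 :=
        CStarRing.norm_of_mem_unitary (Matrix.det_of_mem_unitary hW)
      refine ⟨W.1.det.arg / (2 * Real.pi * m), ?_⟩
      have hd := Complex.norm_mul_exp_arg_mul_I W.1.det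
      rw [hn, Complex.ofReal_one, one_mul] at hd
      rw [← Complex.exp_nat_mul]
      conv_rhs => rw [← hd]
      congr 1
      have hm' : (m : ℂ) ≠ 0 := by exact_mod_cast hm.ne'
      have hp : (Real.pi : ℂ) ≠ 0 := by exact_mod_cast Real.pi_ne_zero
      push_cast
      field_simp
  set c := Complex.exp (2 * Real.pi * Complex.I * x) with hc
  have hcn : star c * c = 1 := by
    rw [hc, Complex.star_def, ← Complex.exp_conj, ← Complex.exp_add]
    simp [Complex.conj_ofNat]
  have hcn' : c * star c = 1 := by rw [mul_comm, hcn]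
  have hS : star c • W.1 ∈ Matrix.specialUnitaryGroup (Fin m) ℂ := by
    rw [Matrix.mem_specialUnitaryGroup_iff]
    constructor
    · rw [Matrix.mem_unitaryGroup_iff', Matrix.star_eq_conjTranspose, Matrix.conjTranspose_smul,
        Matrix.smul_mul, Matrix.mul_smul, smul_smul, star_star, hcn', one_smul]
      exact Matrix.mem_unitaryGroup_iff'.1 hW
    · rw [Matrix.det_smul, Fintype.card_fin, ← hx, ← mul_pow, hcn, one_pow]
  refine ⟨(x, ⟨star c • W.1, hS⟩), Subtype.ext ?_⟩
  change c • (star c • W.1) = W.1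
  rw [smul_smul, hcn', one_smul]

/-- `F` is a lift of the cocycle `(T, A)` to `Θ × ℝ × SU(m)`: a continuous map that covers
`(T, A)` under `(θ, x, S) ↦ (θ, exp(2πix) S)`. -/
def IsLift [TopologicalSpace Θ] {m : ℕ} (T : Θ → Θ) (A : Θ → HSp m)
    (F : Θ × ℝ × SU m → Θ × ℝ × SU m) : Prop :=
  Continuous F ∧ ∀ p, Prod.map id cover (F p) = cocycle T A (Prod.map id cover p)

/-- The function `f : Θ × U(m) → ℝ`, `f(θ, exp(2πix) S) = m (p₂ F(θ, x, S) - x)`, of a lift `F`,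
where `p₂` is the projection to `ℝ`. It is defined here by choosing a point `(x, S)` over each
element of `U(m)`. -/
def increment {m : ℕ} (F : Θ × ℝ × SU m → Θ × ℝ × SU m) (q : Θ × U m) : ℝ :=
  m * ((F (q.1, Function.surjInv (cover_surjective m) q.2)).2.1 -
    (Function.surjInv (cover_surjective m) q.2).1)

theorem integrable_intCast [TopologicalSpace Θ] [CompactSpace Θ] [MeasurableSpace Θ] [BorelSpace Θ]
    (μ : Measure Θ) [IsFiniteMeasure μ] (p : C(Θ, ℤ)) : Integrable (fun θ => (p θ : ℝ)) μ := by
  have hc : Continuous fun θ => (p θ : ℝ) := Int.isClosedEmbedding_coe_real.continuous.comp p.continuous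
  exact hc.integrable_of_hasCompactSupport (HasCompactSupport.of_compactSpace _)

/-- The subgroup `μ(C(Θ, ℤ)) = {∫ p dμ : p ∈ C(Θ, ℤ)}` of `ℝ`. -/
def integerMeans [TopologicalSpace Θ] [CompactSpace Θ] [MeasurableSpace Θ] [BorelSpace Θ]
    (μ : Measure Θ) [IsFiniteMeasure μ] : AddSubgroup ℝ where
  carrier := {c | ∃ p : C(Θ, ℤ), ∫ θ, (p θ : ℝ) ∂μ = c}
  zero_mem' := ⟨0, by simp⟩
  add_mem' := by
    rintro _ _ ⟨p, rfl⟩ ⟨q, rfl⟩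
    refine ⟨p + q, ?_⟩
    rw [← integral_add (integrable_intCast μ p) (integrable_intCast μ q)]
    simp
  neg_mem' := by
    rintro _ ⟨p, rfl⟩
    refine ⟨-p, ?_⟩
    rw [← integral_neg]
    simp

end FiberedRotation

end

open FiberedRotation

/-! Determinants reduce the action on `U m` to a question about arguments. Along the homotopy from
the identity to `A`, the function `det (G_s(θ) · W) / det W` starts at `1`, so it has a continuous
argument, and at the end of the homotopy this gives a real phase `f` with `det (A(θ) · W) = exp (2πi
f(θ, W)) det W` (`exists_isPhase`). Moving `x` by `f / m` produces a lift (`IsPhase.exists_isLift`).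
Since `ℝ × SU m` is connected, the increment of any lift is `f + k` with `k` an integer-valued
continuous function of `θ` alone (`IsLift.exists_eq_phase_add`).

The decisive fact is that the Birkhoff sums of a phase vary by at most `m` on each fibre, whatever
their length (`IsPhase.abs_birkhoffSum_sub_le`). The `n`-th sum is a phase of one matrix `M`, the
product of `A` along the orbit, so a bound uniform over the noncompact group `HSp m` is needed
(`abs_phase_sub_le`). In Moebius form `M · W = (aW + b)(cW + d)⁻¹`, and `det (M · W) / det W = det
(bW⁻¹ + a) / det (cW + d)`. The symplectic relation makes `a` dominate `b` and `d` dominate `c`, so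
`z ↦ det (zcW + d)` is a polynomial of degree at most `m` without zeros in the closed disc. Each
linear factor turns by at most `π / 2` between `z = 0` and `z = 1`, which bounds both arguments by
`mπ / 2`.

Bounded oscillation makes the limit independent of `W`. It also replaces the skew product by its
base: averages of `f` are within `m / N` of averages over `T` of the `N`-th sum at a fixed `W`, to
which Birkhoff's theorem for `μ` applies (`exists_ae_tendsto_birkhoffAverage_skew`). Dominated
convergence then identifies the limit with `∫ f dν` for every invariant `ν` over `μ`. Changing the
lift adds `∫ k dμ`. -/

namespace FiberedRotation

/-! ### Birkhoff's ergodic theorem via the maximal inequality. -/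

section Birkhoff

/-- The running maximum `max (0, S₁, …, Sₙ)` of the Birkhoff sums of `g`. -/
noncomputable def birkhoffMax {X : Type*} (T : X → X) (g : X → ℝ) : ℕ → X → ℝ
  | 0, _ => 0
  | n + 1, x => max 0 (g x + birkhoffMax T g n (T x))

variable {X : Type*} {T : X → X} {g : X → ℝ}

theorem birkhoffMax_succ (n : ℕ) (x : X) :
    birkhoffMax T g (n + 1) x = max 0 (g x + birkhoffMax T g n (T x)) := rfl

theorem birkhoffMax_nonneg (n : ℕ) (x : X) : 0 ≤ birkhoffMax T g n x := by
  cases n with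
  | zero => exact le_rfl
  | succ n => exact le_max_left _ _

theorem birkhoffMax_le_succ (n : ℕ) (x : X) :
    birkhoffMax T g n x ≤ birkhoffMax T g (n + 1) x := by
  induction n generalizing x with
  | zero => exact birkhoffMax_nonneg _ _
  | succ n ih =>
    rw [birkhoffMax_succ, birkhoffMax_succ (n + 1)]
    gcongr
    exact ih _

theorem birkhoffSum_le_birkhoffMax (n : ℕ) (x : X) :
    birkhoffSum T g n x ≤ birkhoffMax T g n x := by
  induction n generalizing x with
  | zero => simp [birkhoffMax]
  | succ n ih =>
    rw [birkhoffSum_succ', birkhoffMax_succ]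
    exact le_max_of_le_right (by gcongr; exact ih _)

/-- Makes the set of points with bounded sums `T`-invariant, so that ergodicity gives it measure `0`
or `1`. -/
theorem bddAbove_birkhoffMax_comp_iff (x : X) :
    BddAbove (Set.range fun n => birkhoffMax T g n (T x)) ↔
      BddAbove (Set.range fun n => birkhoffMax T g n x) := by
  constructor
  · rintro ⟨b, hb⟩
    refine ⟨max 0 (g x + b), ?_⟩
    rintro _ ⟨n, rfl⟩
    refine (birkhoffMax_le_succ n x).trans ?_
    rw [birkhoffMax_succ]
    gcongr
    exact hb ⟨n, rfl⟩
  · rintro ⟨b, hb⟩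
    refine ⟨b - g x, ?_⟩
    rintro _ ⟨n, rfl⟩
    have h1 : birkhoffMax T g (n + 1) x ≤ b := hb ⟨n + 1, rfl⟩
    rw [birkhoffMax_succ] at h1
    have := (le_max_right _ _).trans h1
    dsimp only
    linarith

variable [MeasurableSpace X] {μ : Measure X}

theorem measurable_birkhoffMax (hT : Measurable T) (hg : Measurable g) (n : ℕ) :
    Measurable (birkhoffMax T g n) := by
  induction n with
  | zero => exact measurable_const
  | succ n ih => exact measurable_const.max (hg.add (ih.comp hT))

theorem integrable_birkhoffMax [IsFiniteMeasure μ] (hT : MeasurePreserving T μ μ)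
    (hg : Integrable g μ) (n : ℕ) : Integrable (birkhoffMax T g n) μ := by
  induction n with
  | zero => exact integrable_const 0
  | succ n ih =>
    exact (integrable_const (0 : ℝ)).sup (hg.add (hT.integrable_comp_of_integrable ih))

theorem _root_.MeasureTheory.MeasurePreserving.integral_comp_of_integrable
    (hT : MeasurePreserving T μ μ) {h : X → ℝ} (hh : Integrable h μ) :
    ∫ x, h (T x) ∂μ = ∫ x, h x ∂μ := by
  have := integral_map (μ := μ) hT.measurable.aemeasurable (f := h)
    (by rw [hT.map_eq]; exact hh.aestronglyMeasurable)
  rw [hT.map_eq] at this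
  exact this.symm

/-- If the Birkhoff sums of `g` are almost everywhere unbounded above, then `0 ≤ ∫ g`. -/
theorem integral_nonneg_of_ae_not_bddAbove [IsFiniteMeasure μ] (hT : MeasurePreserving T μ μ)
    (hg : Integrable g μ)
    (h : ∀ᵐ x ∂μ, ¬ BddAbove (Set.range fun n => birkhoffMax T g n x)) :
    0 ≤ ∫ x, g x ∂μ := by
  have hint := integrable_birkhoffMax hT hg
  have hintT : ∀ n, Integrable (fun x => birkhoffMax T g n (T x)) μ := fun n =>
    hT.integrable_comp_of_integrable (hint n)
  -- Invariance of `μ` removes the `T` in the second term, and the running maximum is monotone in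
  -- `n`.
  have key : ∀ n, 0 ≤ ∫ x, (birkhoffMax T g (n + 1) x - birkhoffMax T g n (T x)) ∂μ := by
    intro n
    rw [integral_sub (hint _) (hintT n),
      hT.integral_comp_of_integrable (hint n), sub_nonneg]
    exact integral_mono (hint _) (hint _) fun x => birkhoffMax_le_succ n x
  refine ge_of_tendsto' (tendsto_integral_of_dominated_convergence (fun x => |g x|)
    (fun n => ((hint _).sub (hintT n)).aestronglyMeasurable)
    hg.abs ?_ ?_) key
  · refine fun n => Eventually.of_forall fun x => ?_
    have h0 := birkhoffMax_nonneg (T := T) (g := g) n (T x)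
    simp only [Pi.sub_apply]
    rw [birkhoffMax_succ, Real.norm_eq_abs, abs_le]
    constructor
    · have := le_max_right 0 (g x + birkhoffMax T g n (T x))
      linarith [neg_abs_le (g x)]
    · have : max 0 (g x + birkhoffMax T g n (T x)) ≤ |g x| + birkhoffMax T g n (T x) :=
        max_le (by positivity) (by gcongr; exact le_abs_self _)
      linarith
  · filter_upwards [h] with x hx
    rw [← bddAbove_birkhoffMax_comp_iff] at hx
    have hmono : Monotone fun n => birkhoffMax T g n (T x) :=
      monotone_nat_of_le_succ fun n => birkhoffMax_le_succ n _
    -- Once the maximum at `T x` exceeds `-g x`, the outer `max` is its second argument and the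
    -- integrand equals `g x` exactly.
    have hlim := tendsto_atTop_atTop_of_monotone' hmono hx
    refine tendsto_const_nhds.congr' ?_
    filter_upwards [hlim.eventually_ge_atTop (-g x)] with n hn
    simp only [Pi.sub_apply]
    rw [birkhoffMax_succ, max_eq_right (by linarith)]
    ring

theorem ae_bddAbove_birkhoffMax [IsProbabilityMeasure μ] (hT : Ergodic T μ)
    (hm : Measurable g) (hg : Integrable g μ) (hneg : ∫ x, g x ∂μ < 0) :
    ∀ᵐ x ∂μ, BddAbove (Set.range fun n => birkhoffMax T g n x) := by
  set E := {x | BddAbove (Set.range fun n => birkhoffMax T g n x)} with hE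
  have hEm : MeasurableSet E :=
    measurableSet_bddAbove_range fun n => measurable_birkhoffMax hT.measurable hm n
  have hinv : T ⁻¹' E = E := by
    ext x
    exact bddAbove_birkhoffMax_comp_iff x
  rcases hT.toPreErgodic.prob_eq_zero_or_one hEm hinv with h | h
  · refine absurd (integral_nonneg_of_ae_not_bddAbove hT.toMeasurePreserving hg ?_) hneg.not_ge
    exact measure_eq_zero_iff_ae_notMem.1 h
  · exact (mem_ae_iff_prob_eq_one hEm).2 h

/-- For `c'` strictly between the integral and `c`, the sums of `g - c'` are bounded above almost
everywhere, and division by `n` makes the bound negligible against `c - c'`. -/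
theorem ae_eventually_birkhoffAverage_lt [IsProbabilityMeasure μ] (hT : Ergodic T μ)
    (hm : Measurable g) (hg : Integrable g μ) {c : ℝ} (hc : ∫ x, g x ∂μ < c) :
    ∀ᵐ x ∂μ, ∀ᶠ n in atTop, birkhoffAverage ℝ T g n x < c := by
  obtain ⟨c', h1, h2⟩ := exists_between hc
  have := ae_bddAbove_birkhoffMax hT (g := fun x => g x - c') (hm.sub_const _)
    (hg.sub (integrable_const _)) (by
      rw [integral_sub hg (integrable_const _)]; simpa using h1)
  filter_upwards [this] with x ⟨b, hb⟩
  have hlim : Tendsto (fun n : ℕ => (n : ℝ) * (c - c')) atTop atTop :=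
    tendsto_natCast_atTop_atTop.atTop_mul_const (sub_pos.2 h2)
  filter_upwards [hlim.eventually_gt_atTop b, eventually_gt_atTop 0] with n hn hn0
  have h3 : birkhoffSum T (fun x => g x - c') n x ≤ b :=
    (birkhoffSum_le_birkhoffMax n x).trans (hb ⟨n, rfl⟩)
  have h4 : birkhoffSum T (fun x => g x - c') n x = birkhoffSum T g n x - n * c' := by
    simp [birkhoffSum, Finset.sum_sub_distrib]
  have hn' : (0 : ℝ) < n := by exact_mod_cast hn0
  rw [birkhoffAverage, smul_eq_mul, inv_mul_lt_iff₀ hn']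
  linarith

/-- **Birkhoff's pointwise ergodic theorem** for ergodic maps. -/
theorem ae_tendsto_birkhoffAverage [IsProbabilityMeasure μ] (hT : Ergodic T μ)
    (hm : Measurable g) (hg : Integrable g μ) :
    ∀ᵐ x ∂μ, Tendsto (fun n => birkhoffAverage ℝ T g n x) atTop (𝓝 (∫ x, g x ∂μ)) := by
  have hup : ∀ᵐ x ∂μ, ∀ k : ℕ, ∀ᶠ n in atTop,
      birkhoffAverage ℝ T g n x < ∫ x, g x ∂μ + 1 / (k + 1) :=
    ae_all_iff.2 fun k => ae_eventually_birkhoffAverage_lt hT hm hg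
      (lt_add_of_pos_right _ (by positivity))
  have hlo : ∀ᵐ x ∂μ, ∀ k : ℕ, ∀ᶠ n in atTop,
      birkhoffAverage ℝ T (-g) n x < -∫ x, g x ∂μ + 1 / (k + 1) :=
    ae_all_iff.2 fun k => ae_eventually_birkhoffAverage_lt hT hm.neg hg.neg (by
      simp only [Pi.neg_apply, integral_neg]
      exact lt_add_of_pos_right _ (by positivity))
  filter_upwards [hup, hlo] with x h1 h2
  rw [Metric.tendsto_nhds]
  intro ε hε
  obtain ⟨k, hk⟩ := exists_nat_one_div_lt hε
  filter_upwards [h1 k, h2 k] with n h3 h4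
  rw [birkhoffAverage_neg, Pi.neg_apply, Pi.neg_apply] at h4
  rw [Real.dist_eq, abs_lt]
  constructor <;> linarith

end Birkhoff

/-! ### Skew products with bounded fibre oscillation. -/

section SkewProduct

variable {Θ V : Type*} {T : Θ → Θ} {G : Θ × V → Θ × V} {f : Θ × V → ℝ} {B C : ℝ}

theorem iterate_fst (hG : ∀ q, (G q).1 = T q.1) (n : ℕ) (q : Θ × V) :
    (G^[n] q).1 = T^[n] q.1 := by
  induction n generalizing q with
  | zero => rfl
  | succ n ih => rw [Function.iterate_succ_apply, ih, hG, Function.iterate_succ_apply]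

theorem abs_birkhoffSum_le {X : Type*} {G : X → X} {f : X → ℝ} (hB : ∀ q, |f q| ≤ B) (n : ℕ)
    (q : X) : |birkhoffSum G f n q| ≤ n * B := by
  refine (Finset.abs_sum_le_sum_abs _ _).trans ((Finset.sum_le_sum fun i _ => hB _).trans ?_)
  simp

/-- Splitting the sum of length `n + N` at `n` and at `N` leaves two sums of length `N` as the
difference. -/
theorem abs_birkhoffSum_iterate_sub_le {X : Type*} {G : X → X} {f : X → ℝ}
    (hB : ∀ q, |f q| ≤ B) (n N : ℕ) (q : X) :
    |birkhoffSum G f n (G^[N] q) - birkhoffSum G f n q| ≤ 2 * N * B := by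
  have h1 : birkhoffSum G f n q + birkhoffSum G f N (G^[n] q) =
      birkhoffSum G f N q + birkhoffSum G f n (G^[N] q) := by
    rw [← birkhoffSum_add, ← birkhoffSum_add, add_comm]
  have h2 := abs_le.1 (abs_birkhoffSum_le (G := G) hB N q)
  have h3 := abs_le.1 (abs_birkhoffSum_le (G := G) hB N (G^[n] q))
  rw [abs_le]
  constructor <;> linarith

/-- The double sum is a sum of `N` shifted copies of the `n`-th Birkhoff sum, and each shift by `j <
N` costs at most `2jB`. -/
theorem abs_birkhoffSum_birkhoffSum_sub_le {X : Type*} {G : X → X} {f : X → ℝ}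
    (hB : ∀ q, |f q| ≤ B) (hB0 : 0 ≤ B) (n N : ℕ) (q : X) :
    |birkhoffSum G (birkhoffSum G f N) n q - N * birkhoffSum G f n q| ≤ 2 * N ^ 2 * B := by
  induction N with
  | zero => simp [birkhoffSum]
  | succ N ih =>
    have h1 : birkhoffSum G (birkhoffSum G f (N + 1)) n q =
        birkhoffSum G (birkhoffSum G f N) n q + birkhoffSum G f n (G^[N] q) := by
      simp only [birkhoffSum, Finset.sum_range_succ _ N, Finset.sum_add_distrib]
      congr 1
      refine Finset.sum_congr rfl fun i _ => ?_
      rw [← Function.iterate_add_apply, ← Function.iterate_add_apply, add_comm]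
    have h2 := abs_le.1 (abs_birkhoffSum_iterate_sub_le (G := G) hB n N q)
    have h3 := abs_le.1 ih
    have h4 : 0 ≤ N * B := by positivity
    rw [h1, abs_le]
    push_cast
    constructor <;> nlinarith

/-- If the Birkhoff sums of `f` over a skew product oscillate by at most `C` on the fibres, they
are `C / N`-close to the Birkhoff averages over the base of the `N`-th sum at a section. -/
theorem abs_birkhoffSum_section_sub_le (hG : ∀ q, (G q).1 = T q.1) (hB : ∀ q, |f q| ≤ B)
    (hB0 : 0 ≤ B)
    (hC : ∀ n θ v w, |birkhoffSum G f n (θ, v) - birkhoffSum G f n (θ, w)| ≤ C)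
    (n N : ℕ) (θ : Θ) (v w : V) :
    |birkhoffSum T (fun θ => birkhoffSum G f N (θ, v)) n θ - N * birkhoffSum G f n (θ, w)| ≤
      n * C + 2 * N ^ 2 * B := by
  have h1 : |birkhoffSum T (fun θ => birkhoffSum G f N (θ, v)) n θ -
      birkhoffSum G (birkhoffSum G f N) n (θ, w)| ≤ n * C := by
    rw [birkhoffSum, birkhoffSum, ← Finset.sum_sub_distrib]
    refine (Finset.abs_sum_le_sum_abs _ _).trans
      ((Finset.sum_le_sum (g := fun _ => C) fun i _ => ?_).trans (by simp))
    have : G^[i] (θ, w) = (T^[i] θ, (G^[i] (θ, w)).2) :=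
      Prod.ext (iterate_fst hG i _) rfl
    rw [this]
    exact hC _ _ _ _
  have h2 := abs_birkhoffSum_birkhoffSum_sub_le (G := G) hB hB0 n N (θ, w)
  rw [abs_le] at *
  constructor <;> linarith

theorem tendsto_birkhoffAverage_of_fibre_osc
    (hC : ∀ n θ v w, |birkhoffSum G f n (θ, v) - birkhoffSum G f n (θ, w)| ≤ C)
    {θ : Θ} {v w : V} {ρ : ℝ}
    (h : Tendsto (fun n => birkhoffAverage ℝ G f n (θ, v)) atTop (𝓝 ρ)) :
    Tendsto (fun n => birkhoffAverage ℝ G f n (θ, w)) atTop (𝓝 ρ) := by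
  have h0 : Tendsto (fun n : ℕ => birkhoffAverage ℝ G f n (θ, w) -
      birkhoffAverage ℝ G f n (θ, v)) atTop (𝓝 0) := by
    refine squeeze_zero_norm (fun n => ?_) (tendsto_const_div_atTop_nhds_zero_nat C)
    rw [birkhoffAverage, birkhoffAverage, ← smul_sub, norm_smul, norm_inv, RCLike.norm_natCast,
      Real.norm_eq_abs, inv_mul_eq_div]
    gcongr
    exact hC _ _ _ _
  simpa using h0.add h

/-- A uniformly fibre-bounded skew product over an ergodic base has almost everywhere the same
Birkhoff limit on all points of the fibre. -/
theorem exists_ae_tendsto_birkhoffAverage_skew [Nonempty V] [MeasurableSpace Θ] {μ : Measure Θ}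
    [IsProbabilityMeasure μ] (hT : Ergodic T μ) (hG : ∀ q, (G q).1 = T q.1)
    (hB : ∀ q, |f q| ≤ B)
    (hC : ∀ n θ v w, |birkhoffSum G f n (θ, v) - birkhoffSum G f n (θ, w)| ≤ C)
    (hm : ∀ n v, Measurable fun θ => birkhoffSum G f n (θ, v)) :
    ∃ ρ : ℝ, ∀ᵐ θ ∂μ, ∀ v,
      Tendsto (fun n => birkhoffAverage ℝ G f n (θ, v)) atTop (𝓝 ρ) := by
  obtain ⟨v⟩ := ‹Nonempty V›
  obtain ⟨θ'⟩ : Nonempty Θ := nonempty_of_isProbabilityMeasure μ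
  have hB0 : 0 ≤ B := (abs_nonneg _).trans (hB (θ', v))
  have hC0 : 0 ≤ C := (abs_nonneg _).trans (hC 0 θ' v v)
  set s : ℕ → Θ → ℝ := fun N θ => birkhoffSum G f N (θ, v) with hs
  have hint : ∀ N, Integrable (s N) μ := fun N =>
    .of_bound (hm N v).aestronglyMeasurable (N * B)
      (Eventually.of_forall fun θ => abs_birkhoffSum_le hB N _)
  -- The block length is `k + 1` to avoid dividing by zero.
  set c : ℕ → ℝ := fun k => (∫ θ, s (k + 1) θ ∂μ) / (k + 1) with hc
  have hae : ∀ᵐ θ ∂μ, ∀ k : ℕ, Tendsto (fun n => birkhoffAverage ℝ T (s (k + 1)) n θ) atTop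
      (𝓝 (∫ θ, s (k + 1) θ ∂μ)) :=
    ae_all_iff.2 fun k => ae_tendsto_birkhoffAverage hT (hm _ v) (hint _)
  have hclose : ∀ᵐ θ ∂μ, ∀ k : ℕ, ∀ ε > 0, ∀ᶠ n in atTop,
      |birkhoffAverage ℝ G f n (θ, v) - c k| ≤ C / (k + 1) + ε := by
    filter_upwards [hae] with θ h k ε hε
    have hk : (0 : ℝ) < k + 1 := by positivity
    have h1 := (h k).div_const ((k : ℝ) + 1)
    have h2 : Tendsto (fun n : ℕ => 2 * ((k + 1 : ℕ) : ℝ) ^ 2 * B / (k + 1) / (n : ℝ)) atTop (𝓝 0) :=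
      tendsto_const_div_atTop_nhds_zero_nat _
    filter_upwards [Metric.tendsto_nhds.1 h1 (ε / 2) (half_pos hε),
      h2.eventually_lt_const (half_pos hε), eventually_gt_atTop 0] with n h3 h4 hn0
    have hn : (0 : ℝ) < n := by exact_mod_cast hn0
    have h5 := abs_birkhoffSum_section_sub_le hG hB hB0 hC n (k + 1) θ v v
    have h6 : |birkhoffAverage ℝ T (s (k + 1)) n θ / (k + 1) - birkhoffAverage ℝ G f n (θ, v)| ≤
        C / (k + 1) + 2 * ((k + 1 : ℕ) : ℝ) ^ 2 * B / (k + 1) / n := by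
      have h7 : birkhoffAverage ℝ T (s (k + 1)) n θ / (k + 1) - birkhoffAverage ℝ G f n (θ, v) =
          (birkhoffSum T (s (k + 1)) n θ - ((k + 1 : ℕ) : ℝ) * birkhoffSum G f n (θ, v)) /
            (n * (k + 1)) := by
        simp only [birkhoffAverage, smul_eq_mul]
        push_cast
        field_simp
      rw [h7, abs_div, abs_of_pos (by positivity : (0 : ℝ) < n * (k + 1)),
        div_le_iff₀ (by positivity)]
      refine h5.trans (le_of_eq ?_)
      field_simp
    rw [Real.dist_eq] at h3
    have h8 := abs_lt.1 h3
    have h9 := abs_le.1 h6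
    rw [abs_le]
    constructor <;> linarith
  -- The numbers `c k` do not depend on `θ`, so a single good `θ` and a single large `n` compare any
  -- two of them.
  have hcc : ∀ k l : ℕ, |c k - c l| ≤ C / (k + 1) + C / (l + 1) := by
    intro k l
    obtain ⟨θ, hθ⟩ := hclose.exists
    refine le_of_forall_pos_le_add fun ε hε => ?_
    obtain ⟨n, h1, h2⟩ := ((hθ k (ε / 2) (half_pos hε)).and (hθ l (ε / 2) (half_pos hε))).exists
    rw [abs_le] at *
    constructor <;> linarith
  have hC1 : Tendsto (fun k : ℕ => C / ((k : ℝ) + 1)) atTop (𝓝 0) := by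
    simpa [div_eq_mul_inv] using tendsto_one_div_add_atTop_nhds_zero_nat.const_mul C
  have hcauchy : CauchySeq c := by
    refine cauchySeq_of_le_tendsto_0 (fun N : ℕ => C / ((N : ℝ) + 1) + C / (N + 1))
      (fun k l N hk hl => (hcc k l).trans ?_) (by simpa using hC1.add hC1)
    gcongr
  obtain ⟨ρ, hρ⟩ := cauchySeq_tendsto_of_complete hcauchy
  refine ⟨ρ, ?_⟩
  filter_upwards [hclose] with θ h w
  refine tendsto_birkhoffAverage_of_fibre_osc hC (v := v) ?_
  rw [Metric.tendsto_nhds]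
  intro ε hε
  have h4 : 0 < ε / 4 := by positivity
  obtain ⟨k, hk1, hk2⟩ := ((Metric.tendsto_nhds.1 hρ (ε / 4) h4).and
    (hC1.eventually_lt_const h4)).exists
  filter_upwards [h k (ε / 4) h4] with n hn
  rw [Real.dist_eq] at *
  rw [abs_lt] at *
  rw [abs_le] at hn
  constructor <;> linarith

/-- By invariance all averages with `n > 0` have the integral of `f`, and they are uniformly bounded
by `B`, so dominated convergence applies. -/
theorem integral_eq_of_ae_tendsto_birkhoffAverage {X : Type*} [MeasurableSpace X] {ν : Measure X}
    [IsProbabilityMeasure ν] {G : X → X} {f : X → ℝ} (hG : MeasurePreserving G ν ν)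
    (hf : Integrable f ν) (hB : ∀ q, |f q| ≤ B) {ρ : ℝ}
    (h : ∀ᵐ q ∂ν, Tendsto (fun n => birkhoffAverage ℝ G f n q) atTop (𝓝 ρ)) :
    ∫ q, f q ∂ν = ρ := by
  have hi : ∀ n : ℕ, Integrable (fun q => f (G^[n] q)) ν := fun n =>
    (hG.iterate n).integrable_comp_of_integrable hf
  have hS : ∀ n, Integrable (birkhoffSum G f n) ν := fun n =>
    integrable_finsetSum _ fun i _ => hi i
  have hB0 : 0 ≤ B := by
    obtain ⟨q⟩ : Nonempty X := nonempty_of_isProbabilityMeasure ν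
    exact (abs_nonneg _).trans (hB q)
  have h1 : Tendsto (fun n => ∫ q, birkhoffAverage ℝ G f n q ∂ν) atTop (𝓝 (∫ _, ρ ∂ν)) := by
    refine tendsto_integral_of_dominated_convergence (fun _ => B)
      (fun n => ((hS n).smul ((n : ℝ)⁻¹)).aestronglyMeasurable) (integrable_const _) ?_ h
    refine fun n => Eventually.of_forall fun q => ?_
    rw [birkhoffAverage, norm_smul, norm_inv, RCLike.norm_natCast, Real.norm_eq_abs]
    rcases n.eq_zero_or_pos with rfl | hn
    · simpa using hB0
    · rw [inv_mul_le_iff₀ (by exact_mod_cast hn)]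
      exact abs_birkhoffSum_le hB n q
  have h2 : ∀ᶠ n : ℕ in atTop, ∫ q, birkhoffAverage ℝ G f n q ∂ν = ∫ q, f q ∂ν := by
    filter_upwards [eventually_gt_atTop 0] with n hn
    have hn' : (n : ℝ) ≠ 0 := by exact_mod_cast hn.ne'
    simp only [birkhoffAverage, birkhoffSum, smul_eq_mul]
    rw [integral_const_mul, integral_finsetSum _ fun i _ => hi i]
    simp only [fun i => (hG.iterate i).integral_comp_of_integrable hf]
    simp [hn']
  have h3 := tendsto_nhds_unique (tendsto_const_nhds.congr' (EventuallyEq.symm h2)) h1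
  simpa using h3

end SkewProduct

/-! ### Continuous arguments and the argument of a polynomial without zeros in the disc. -/

section ArgLift

open unitInterval

variable {X : Type*} [TopologicalSpace X]

/-- A homotopy of nonvanishing functions starting at the constant function `1` has a continuous
argument starting at `0`. -/
theorem exists_arg_lift {H : I × X → ℂ} (hH : Continuous H) (h0 : ∀ p, H p ≠ 0)
    (h1 : ∀ x, H (0, x) = 1) :
    ∃ φ : I × X → ℝ, Continuous φ ∧ (∀ x, φ (0, x) = 0) ∧
      ∀ p, H p = ‖H p‖ * Complex.exp (φ p * Complex.I) := by
  have hn : ∀ p, H p / ‖H p‖ ∈ Submonoid.unitSphere ℂ := fun p => by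
    refine mem_sphere_zero_iff_norm.2 ?_
    simp [h0 p]
  have hc : Continuous fun p => H p / ‖H p‖ :=
    hH.div (Complex.continuous_ofReal.comp hH.norm) fun p => by simpa using h0 p
  let c : C(I × X, Circle) := ⟨fun p => ⟨H p / ‖H p‖, hn p⟩, hc.subtype_mk _⟩
  have hstart : ∀ x, c (0, x) = Circle.exp ((ContinuousMap.const X (0 : ℝ)) x) := fun x => by
    apply Circle.ext
    change H (0, x) / ‖H (0, x)‖ = _
    simp [h1]
  refine ⟨Circle.isCoveringMap_exp.liftHomotopy c (.const X 0) hstart, ContinuousMap.continuous _,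
    fun x => Circle.isCoveringMap_exp.liftHomotopy_zero c (.const X 0) hstart x, fun p => ?_⟩
  have := congrArg Circle.coeHom
    (congrFun (Circle.isCoveringMap_exp.liftHomotopy_lifts c (.const X 0) hstart) p)
  rw [Function.comp_apply] at this
  change ((Circle.exp _ : Circle) : ℂ) = H p / ‖H p‖ at this
  rw [Circle.coe_exp] at this
  rw [this]
  have : (‖H p‖ : ℂ) ≠ 0 := by simpa using h0 p
  field_simp

theorem exists_continuousMap_int {g : X → ℝ} (hg : Continuous g)
    (h : ∀ x, Complex.exp (2 * Real.pi * Complex.I * g x) = 1) :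
    ∃ k : C(X, ℤ), ∀ x, g x = k x := by
  have h1 : ∀ x, ∃ k : ℤ, g x = k := by
    intro x
    obtain ⟨k, hk⟩ := Complex.exp_eq_one_iff.1 (h x)
    refine ⟨k, ?_⟩
    have h2 : (2 * Real.pi * Complex.I : ℂ) ≠ 0 := Complex.two_pi_I_ne_zero
    rw [mul_comm (k : ℂ)] at hk
    exact_mod_cast mul_left_cancel₀ h2 hk
  choose k hk using h1
  refine ⟨⟨k, Int.isClosedEmbedding_coe_real.isInducing.continuous_iff.2 ?_⟩, hk⟩
  exact hg.congr hk

/-- The differences of values of `g` are integers depending continuously on the point of a connected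
space. -/
theorem eq_of_exp_two_pi_eq [PreconnectedSpace X] {g : X → ℝ} (hg : Continuous g) {c : ℂ}
    (h : ∀ x, Complex.exp (2 * Real.pi * Complex.I * g x) = c) (x y : X) : g x = g y := by
  obtain ⟨k, hk⟩ := exists_continuousMap_int (g := fun z => g z - g y) (hg.sub continuous_const)
    (fun z => by
      push_cast
      rw [mul_sub, Complex.exp_sub, h, h, div_self]
      rw [← h y]
      exact Complex.exp_ne_zero _)
  have h1 := hk x
  rw [PreconnectedSpace.constant inferInstance k.continuous (x := x) (y := y), ← hk y] at h1
  linarith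

theorem eq_of_exp_mul_I_eq [PreconnectedSpace X] {g : X → ℝ} (hg : Continuous g) {c : ℂ}
    (h : ∀ x, Complex.exp (g x * Complex.I) = c) (x y : X) : g x = g y := by
  have := eq_of_exp_two_pi_eq (g := fun x => g x / (2 * Real.pi)) (hg.div_const _) (c := c)
    (fun x => by
      rw [← h x]
      congr 1
      have : (Real.pi : ℂ) ≠ 0 := by exact_mod_cast Real.pi_ne_zero
      push_cast
      field_simp) x y
  have hp : (2 * Real.pi) ≠ 0 := by positivity
  exact (div_left_inj' hp).1 this

/-- In the right half-plane the principal argument is continuous and smaller than `π / 2` in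
absolute value. -/
theorem one_sub_div_re_pos {z : ℂ} (hz : 1 < ‖z‖) (s : I) : 0 < (1 - (s : ℂ) / z).re := by
  have h1 : ‖(s : ℂ) / z‖ < 1 := by
    rw [norm_div, div_lt_one (by linarith), Complex.norm_real, Real.norm_of_nonneg s.2.1]
    exact s.2.2.trans_lt hz
  have h2 := (Complex.re_le_norm _).trans_lt h1
  rw [Complex.sub_re, Complex.one_re]
  linarith

/-- The total argument of the product of the factors `1 - s / z`. -/
noncomputable def sumArg (S : Multiset ℂ) (s : I) : ℝ :=
  (S.map fun z => (1 - (s : ℂ) / z).arg).sum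

theorem continuous_sumArg {S : Multiset ℂ} (hS : ∀ z ∈ S, 1 < ‖z‖) : Continuous (sumArg S) := by
  induction S using Multiset.induction with
  | empty => exact continuous_const
  | cons z S ih =>
    have hz := hS z (Multiset.mem_cons_self _ _)
    have h1 : Continuous fun s : I => (1 - (s : ℂ) / z).arg := by
      refine continuous_iff_continuousAt.2 fun s => ?_
      have hc : Continuous fun s : I => 1 - (s : ℂ) / z :=
        continuous_const.sub ((Complex.continuous_ofReal.comp continuous_subtype_val).div_const _)
      exact ContinuousAt.comp (f := fun s : I => 1 - (s : ℂ) / z)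
        (Complex.continuousAt_arg (Or.inl (one_sub_div_re_pos hz s))) hc.continuousAt
    have := h1.add (ih fun w hw => hS w (Multiset.mem_cons_of_mem hw))
    exact this.congr fun s => by simp [sumArg]

theorem abs_sumArg_le {S : Multiset ℂ} (hS : ∀ z ∈ S, 1 < ‖z‖) (s : I) :
    |sumArg S s| ≤ S.card * (Real.pi / 2) := by
  induction S using Multiset.induction with
  | empty => simp [sumArg]
  | cons z S ih =>
    have h1 := ih fun w hw => hS w (Multiset.mem_cons_of_mem hw)
    have h2 : |(1 - (s : ℂ) / z).arg| ≤ Real.pi / 2 := (Complex.abs_arg_lt_pi_div_two_iff.2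
      (Or.inl (one_sub_div_re_pos (hS z (Multiset.mem_cons_self _ _)) s))).le
    have h3 : sumArg (z ::ₘ S) s = (1 - (s : ℂ) / z).arg + sumArg S s := by simp [sumArg]
    rw [h3, Multiset.card_cons]
    push_cast
    linarith [abs_add_le (1 - (s : ℂ) / z).arg (sumArg S s)]

theorem prod_eq_norm_mul_exp_sumArg (S : Multiset ℂ) (s : I) :
    (S.map fun z => 1 - (s : ℂ) / z).prod =
      ‖(S.map fun z => 1 - (s : ℂ) / z).prod‖ * Complex.exp (sumArg S s * Complex.I) := by
  induction S using Multiset.induction with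
  | empty => simp [sumArg]
  | cons z S ih =>
    have h3 : sumArg (z ::ₘ S) s = (1 - (s : ℂ) / z).arg + sumArg S s := by simp [sumArg]
    rw [h3, Multiset.map_cons, Multiset.prod_cons, norm_mul]
    push_cast
    rw [add_mul, Complex.exp_add]
    conv_lhs => rw [ih, ← Complex.norm_mul_exp_arg_mul_I (1 - (s : ℂ) / z)]
    ring

/-- The argument of a polynomial without roots in the closed unit disc changes along `[0, 1]` by at
most `π / 2` times the degree. -/
theorem abs_arg_polynomial_le {p : Polynomial ℂ} (hp : ∀ z : ℂ, ‖z‖ ≤ 1 → p.eval z ≠ 0)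
    {φ : I → ℝ} (hφ : Continuous φ) (hφ0 : φ 0 = 0)
    (h : ∀ s : I, p.eval (s : ℂ) / p.eval 0 =
      ‖p.eval (s : ℂ) / p.eval 0‖ * Complex.exp (φ s * Complex.I)) :
    |φ 1| ≤ p.natDegree * (Real.pi / 2) := by
  have hroots : ∀ z ∈ p.roots, 1 < ‖z‖ := fun z hz => by
    by_contra! h'
    exact hp z h' (Polynomial.isRoot_of_mem_roots hz)
  have h0 : ∀ S : Multiset ℂ, (∀ z ∈ S, 1 < ‖z‖) → ∀ s : ℂ,
      (S.map fun z => s - z).prod / (S.map fun z => 0 - z).prod =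
        (S.map fun z => 1 - s / z).prod := by
    intro S hS s
    rw [← Multiset.prod_map_div]
    congr 1
    refine Multiset.map_congr rfl fun z hz => ?_
    have : z ≠ 0 := norm_pos_iff.1 (zero_lt_one.trans (hS z hz))
    field_simp
    ring
  have hlead : p.leadingCoeff ≠ 0 := by
    intro h'
    rw [Polynomial.leadingCoeff_eq_zero] at h'
    exact hp 0 (by simp) (by simp [h'])
  have hfac : ∀ s : ℂ, p.eval s / p.eval 0 = (p.roots.map fun z => 1 - s / z).prod := by
    intro s
    have hs := IsAlgClosed.splits p
    rw [hs.eval_eq_prod_roots, hs.eval_eq_prod_roots, mul_div_mul_left _ _ hlead,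
      h0 _ hroots]
  -- Two continuous arguments of the same nonvanishing function differ by a constant, and both
  -- vanish at `0`.
  have hconst := eq_of_exp_mul_I_eq (g := fun s => φ s - sumArg p.roots s) (c := 1)
    (hφ.sub (continuous_sumArg hroots)) (fun s => by
      have h1 := prod_eq_norm_mul_exp_sumArg p.roots s
      rw [← hfac] at h1
      have h2 := (h s).symm.trans h1
      have h3 : (‖p.eval (s : ℂ) / p.eval 0‖ : ℂ) ≠ 0 := by
        have : p.eval (s : ℂ) ≠ 0 := hp _ (by
          rw [Complex.norm_real, Real.norm_of_nonneg s.2.1]; exact s.2.2)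
        simp [this, hp 0 (by simp)]
      have h4 := mul_left_cancel₀ h3 h2
      push_cast
      rw [sub_mul, Complex.exp_sub, h4, div_self (Complex.exp_ne_zero _)]) 1 0
  have h5 : sumArg p.roots 0 = 0 := by simp [sumArg]
  simp only [hφ0, h5, sub_zero] at hconst
  rw [sub_eq_zero.1 hconst]
  refine (abs_sumArg_le hroots 1).trans ?_
  gcongr
  exact p.card_roots'

end ArgLift

/-! ### Compactness and connectedness of the unitary groups. -/

section UnitaryTopology

variable {m : ℕ}

instance instSecondCountableTopologyU : SecondCountableTopology (U m) :=
  inferInstanceAs (SecondCountableTopology {A : Fin m → Fin m → ℂ // A ∈ Matrix.unitaryGroup _ ℂ})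

instance instCompactSpaceU : CompactSpace (U m) := by
  have hK : IsCompact {A : Matrix (Fin m) (Fin m) ℂ | ∀ i j, A i j ∈ Metric.closedBall (0 : ℂ) 1} := by
    have h := isCompact_univ_pi fun _ : Fin m => isCompact_univ_pi fun _ : Fin m =>
      isCompact_closedBall (0 : ℂ) 1
    refine (congrArg IsCompact (Set.ext fun A => ?_)).mp h
    exact ⟨fun hA i j => hA i trivial j trivial, fun hA i _ j _ => hA i j⟩
  refine isCompact_iff_compactSpace.1 (hK.of_isClosed_subset ?_ ?_)
  · have h : Continuous fun A : Matrix (Fin m) (Fin m) ℂ => star A * A :=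
      continuous_star.mul continuous_id
    have := isClosed_singleton (x := (1 : Matrix (Fin m) (Fin m) ℂ)) |>.preimage h
    convert this using 1
    exact Set.ext fun A => Matrix.mem_unitaryGroup_iff'
  · exact fun A hA i j => mem_closedBall_zero_iff.2 (entry_norm_bound_of_unitary hA i j)

/-- The scalar unitary matrix `exp (it)`. -/
noncomputable def scalarU (m : ℕ) (t : ℝ) : U m :=
  ⟨Complex.exp (t * Complex.I) • 1, by
    rw [Matrix.mem_unitaryGroup_iff']
    have : star (Complex.exp (t * Complex.I)) * Complex.exp (t * Complex.I) = 1 := by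
      rw [Complex.star_def, ← Complex.exp_conj, ← Complex.exp_add]
      simp
    rw [star_smul, star_one, smul_mul_smul_comm, this, one_smul, one_mul]⟩

theorem continuous_scalarU : Continuous (scalarU m) := by
  refine Continuous.subtype_mk ?_ _
  have : Continuous fun t : ℝ => Complex.exp (t * Complex.I) := by fun_prop
  exact this.smul continuous_const

open scoped Matrix.Norms.L2Operator in
-- The spectrum of `W` is finite, so some `exp (it)` avoids it. Then `W` is at distance less than
-- `2` from the opposite scalar `-exp (it)`, and unitaries this close are joined by a path.
theorem exists_joined_scalarU (W : U m) : ∃ t, Joined (scalarU m t) W := by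
  have hfin := Matrix.finite_spectrum (R := ℂ) W.1
  have hinf : (Set.range fun t : ℝ => ((Circle.exp t : Circle) : ℂ)).Infinite := by
    have h1 : Set.InjOn (fun t : ℝ => ((Circle.exp t : Circle) : ℂ))
        (Set.Ioc (-Real.pi) Real.pi) := by
      intro s hs t ht hst
      rw [← Circle.arg_exp hs.1 hs.2, ← Circle.arg_exp ht.1 ht.2]
      exact congrArg Complex.arg hst
    exact ((Set.Ioc_infinite (by linarith [Real.pi_pos])).image h1).mono
      (Set.image_subset_range _ _)
  obtain ⟨z, ⟨t, rfl⟩, hz⟩ := (hinf.sdiff hfin).nonempty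
  -- Adding `π` turns the missing eigenvalue `exp (it)` of `W` into the missing eigenvalue `-1` of
  -- `V` below.
  refine ⟨t + Real.pi, Unitary.joined _ _ ?_⟩
  have hexp : (scalarU m (t + Real.pi)).1 = -(Complex.exp (t * Complex.I) • 1) := by
    change Complex.exp (((t + Real.pi : ℝ) : ℂ) * Complex.I) • _ = _
    push_cast
    rw [add_mul, Complex.exp_add, Complex.exp_pi_mul_I, mul_neg_one, neg_smul]
  set V : U m := (scalarU m (t + Real.pi))⁻¹ * W with hV
  have hSV : W = scalarU m (t + Real.pi) * V := by rw [hV, mul_inv_cancel_left]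
  have hspec : spectrum ℂ V.1 ⊆ Complex.slitPlane := by
    intro l hl
    have hl1 : ‖l‖ = 1 := by
      simpa using Unitary.spectrum_subset_circle V hl
    by_contra hs
    rw [Complex.mem_slitPlane_iff, not_or, not_lt, not_not] at hs
    have hl2 : l = -1 := by
      have h1 : l = (l.re : ℂ) := Complex.ext rfl hs.2
      rw [h1, Complex.norm_real, Real.norm_of_nonpos hs.1] at hl1
      rw [h1, ← neg_neg l.re, hl1]
      simp
    subst hl2
    refine hz (fun hunit => hl ?_)
    have h2 : (algebraMap ℂ (Matrix (Fin m) (Fin m) ℂ)) ((Circle.exp t : Circle) : ℂ) - W.1 =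
        (scalarU m (t + Real.pi)).1 * (algebraMap ℂ (Matrix (Fin m) (Fin m) ℂ) (-1) - V.1) := by
      rw [mul_sub, ← Matrix.UnitaryGroup.mul_val, ← hSV, hexp, Circle.coe_exp]
      simp [Algebra.algebraMap_eq_smul_one]
    change IsUnit ((algebraMap ℂ (Matrix (Fin m) (Fin m) ℂ)) ((Circle.exp t : Circle) : ℂ) - W.1)
      at hunit
    rw [h2] at hunit
    have h3 : IsUnit (scalarU m (t + Real.pi)).1 :=
      IsUnit.of_mul_eq_one _ (Matrix.mem_unitaryGroup_iff.1 (scalarU m (t + Real.pi)).2)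
    exact (h3.mul_left_iff).1 hunit
  have hnorm := (Unitary.spectrum_subset_slitPlane_iff_norm_lt_two V.2).1 hspec
  have h4 : W.1 - (scalarU m (t + Real.pi)).1 = (scalarU m (t + Real.pi)).1 * (V.1 - 1) := by
    rw [mul_sub, mul_one, ← Matrix.UnitaryGroup.mul_val, ← hSV]
  rw [h4, CStarRing.norm_mem_unitary_mul _ (scalarU m (t + Real.pi)).2]
  exact hnorm

/-- The scalars form a connected set that meets every path component. -/
instance instPreconnectedSpaceU : PreconnectedSpace (U m) := by
  have hs : IsConnected (Set.range (scalarU m)) :=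
    isConnected_range continuous_scalarU
  have : ∀ W : U m, W ∈ connectedComponent (scalarU m 0) := by
    intro W
    obtain ⟨t, ht⟩ := exists_joined_scalarU W
    have h1 : scalarU m t ∈ connectedComponent (scalarU m 0) :=
      hs.2.subset_connectedComponent ⟨0, rfl⟩ ⟨t, rfl⟩
    rw [connectedComponent_eq h1]
    exact pathComponent_subset_component _ ht
  exact ⟨by
    have h : (Set.univ : Set (U m)) = connectedComponent (scalarU m 0) :=
      (Set.eq_univ_of_forall this).symm
    rw [h]
    exact isPreconnected_connectedComponent⟩

/-- The diagonal matrix with first entry `c` and all other entries `1`. -/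
def diagFirst (m : ℕ) [NeZero m] (c : ℂ) : Matrix (Fin m) (Fin m) ℂ :=
  Matrix.diagonal (Function.update 1 0 c)

theorem det_diagFirst [NeZero m] (c : ℂ) : (diagFirst m c).det = c := by
  rw [diagFirst, Matrix.det_diagonal, Finset.prod_update_of_mem (Finset.mem_univ _)]
  simp

theorem diagFirst_mem [NeZero m] {c : ℂ} (hc : star c * c = 1) :
    diagFirst m c ∈ Matrix.unitaryGroup (Fin m) ℂ := by
  rw [Matrix.mem_unitaryGroup_iff', diagFirst, Matrix.star_eq_conjTranspose,
    Matrix.diagonal_conjTranspose, Matrix.diagonal_mul_diagonal, ← Matrix.diagonal_one]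
  congr 1
  ext i
  by_cases h : i = 0
  · subst h; simpa using hc
  · simp [h]

theorem star_det_mul_det (W : U m) : star W.1.det * W.1.det = 1 :=
  (Unitary.mem_iff.1 (Matrix.det_of_mem_unitary W.2)).1

theorem det_mul_star_det (W : U m) : W.1.det * star W.1.det = 1 :=
  (Unitary.mem_iff.1 (Matrix.det_of_mem_unitary W.2)).2

theorem det_ne_zero (W : U m) : W.1.det ≠ 0 :=
  left_ne_zero_of_mul_eq_one (det_mul_star_det W)

theorem norm_det (W : U m) : ‖W.1.det‖ = 1 :=
  CStarRing.norm_of_mem_unitary (Matrix.det_of_mem_unitary W.2)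

theorem continuous_det : Continuous fun W : U m => W.1.det :=
  Continuous.matrix_det continuous_subtype_val

/-- A retraction of `U(m)` onto `SU(m)`. -/
def retractSU (m : ℕ) [NeZero m] (W : U m) : SU m :=
  ⟨W.1 * diagFirst m (star W.1.det), by
    rw [Matrix.mem_specialUnitaryGroup_iff, Matrix.det_mul, det_diagFirst]
    exact ⟨mul_mem W.2 (diagFirst_mem (by rw [star_star]; exact det_mul_star_det W)),
      det_mul_star_det W⟩⟩

theorem continuous_retractSU [NeZero m] : Continuous (retractSU m) := by
  refine Continuous.subtype_mk (continuous_subtype_val.mul ?_) _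
  refine Continuous.matrix_diagonal ?_
  exact continuous_const.update 0 continuous_det.star

theorem retractSU_coe [NeZero m] (S : SU m) :
    retractSU m ⟨S.1, (Matrix.mem_specialUnitaryGroup_iff.1 S.2).1⟩ = S := by
  apply Subtype.ext
  change S.1 * diagFirst m (star S.1.det) = S.1
  rw [(Matrix.mem_specialUnitaryGroup_iff.1 S.2).2, star_one, diagFirst]
  simp

theorem preconnectedSpace_SU [NeZero m] : PreconnectedSpace (SU m) :=
  have h : Set.range (retractSU m) = Set.univ :=
    Set.eq_univ_of_forall fun S => ⟨_, retractSU_coe S⟩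
  ⟨h ▸ isPreconnected_range continuous_retractSU⟩

end UnitaryTopology

/-! ### The Moebius form of the action and the uniform phase bound. -/

section Moebius

variable {m : ℕ}

theorem vecMul_dotProduct_star (A : Matrix (Fin m) (Fin m) ℂ) (v : Fin m → ℂ) :
    (v ᵥ* A) ⬝ᵥ star (v ᵥ* A) = (v ᵥ* (A * Aᴴ)) ⬝ᵥ star v := by
  rw [Matrix.star_vecMul, Matrix.dotProduct_mulVec, Matrix.vecMul_vecMul]

theorem dotProduct_star_eq (v : Fin m → ℂ) : v ⬝ᵥ star v = ((∑ i, ‖v i‖ ^ 2 : ℝ) : ℂ) := by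
  simp [dotProduct, Complex.mul_conj']

/-- A left null vector `v` satisfies `v d = -z v c W`. Comparing squared norms gives `‖v c‖² + 4
‖v‖² = |z|² ‖v c‖²`, which forces `v = 0` when `|z| ≤ 1`. -/
theorem det_add_smul_mul_ne_zero {c d W : Matrix (Fin m) (Fin m) ℂ}
    (h : d * dᴴ = c * cᴴ + (4 : ℂ) • 1) (hW : W * Wᴴ = 1) {z : ℂ} (hz : ‖z‖ ≤ 1) :
    (z • (c * W) + d).det ≠ 0 := by
  intro hdet
  obtain ⟨v, hv, hv0⟩ := Matrix.exists_vecMul_eq_zero_iff.2 hdet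
  rw [Matrix.vecMul_add, add_comm, ← eq_neg_iff_add_eq_zero] at hv0
  have h1 := vecMul_dotProduct_star d v
  have h2 := vecMul_dotProduct_star (z • (c * W)) v
  have h3 := vecMul_dotProduct_star c v
  have h4 : (z • (c * W)) * (z • (c * W))ᴴ = ((‖z‖ ^ 2 : ℝ) : ℂ) • (c * cᴴ) := by
    rw [Matrix.conjTranspose_smul, smul_mul_smul_comm, Complex.star_def, Complex.mul_conj',
      Matrix.conjTranspose_mul, Matrix.mul_assoc, ← Matrix.mul_assoc W, hW, Matrix.one_mul]
    push_cast
    rfl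
  rw [hv0, star_neg, neg_dotProduct_neg, h2, h4, h, Matrix.vecMul_add, add_dotProduct,
    Matrix.vecMul_smul, Matrix.vecMul_smul, smul_dotProduct, smul_dotProduct, ← h3,
    Matrix.vecMul_one, dotProduct_star_eq, dotProduct_star_eq, smul_eq_mul, smul_eq_mul] at h1
  have h5 : ‖z‖ ^ 2 * ∑ i, ‖(v ᵥ* c) i‖ ^ 2 = ∑ i, ‖(v ᵥ* c) i‖ ^ 2 + 4 * ∑ i, ‖v i‖ ^ 2 := by
    exact_mod_cast h1
  have h6 : 0 ≤ ∑ i, ‖(v ᵥ* c) i‖ ^ 2 := by positivity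
  have h7 : ‖z‖ ^ 2 ≤ 1 := pow_le_one₀ (norm_nonneg _) hz
  have h8 : ∑ i, ‖v i‖ ^ 2 ≤ 0 := by nlinarith
  have h9 := (Finset.sum_eq_zero_iff_of_nonneg fun i _ => by positivity).1
    (h8.antisymm (by positivity))
  exact hv (funext fun i => by simpa using h9 i (Finset.mem_univ i))

theorem eval_det_X_smul_add (B D : Matrix (Fin m) (Fin m) ℂ) (z : ℂ) :
    ((Polynomial.X : Polynomial ℂ) • B.map Polynomial.C + D.map Polynomial.C).det.eval z =
      (z • B + D).det := by
  rw [← Polynomial.coe_evalRingHom, RingHom.map_det]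
  congr 1
  ext i j
  simp only [RingHom.mapMatrix_apply, Matrix.map_apply, Matrix.add_apply, Matrix.smul_apply,
    smul_eq_mul, Polynomial.coe_evalRingHom, Polynomial.eval_add, Polynomial.eval_C,
    Polynomial.eval_mul, Polynomial.eval_X]

theorem exists_arg_det {c d : Matrix (Fin m) (Fin m) ℂ}
    (h : d * dᴴ = c * cᴴ + (4 : ℂ) • 1) :
    ∃ φ : U m → ℝ, Continuous φ ∧ (∀ W, |φ W| ≤ m * (Real.pi / 2)) ∧
      ∀ W : U m, (c * W.1 + d).det =
        d.det * (‖(c * W.1 + d).det / d.det‖ * Complex.exp (φ W * Complex.I)) := by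
  have hd : d.det ≠ 0 := by
    have := det_add_smul_mul_ne_zero h (W := 1) (by simp) (z := 0) (by simp)
    simpa using this
  -- Shrinking the `W`-term to zero connects the normalised determinant to the constant `1`; on real
  -- `s` it is a polynomial in `s`.
  let H : unitInterval × U m → ℂ := fun p => ((p.1 : ℂ) • (c * p.2.1) + d).det / d.det
  have hW : ∀ W : U m, W.1 * W.1ᴴ = 1 := fun W => Matrix.mem_unitaryGroup_iff.1 W.2
  obtain ⟨φ, hφc, hφ0, hφ⟩ := exists_arg_lift (H := H)
    (by
      refine Continuous.div_const (Continuous.matrix_det ?_) _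
      have h1 : Continuous fun p : unitInterval × U m => ((p.1 : ℝ) : ℂ) :=
        Complex.continuous_ofReal.comp (continuous_subtype_val.comp continuous_fst)
      have h2 : Continuous fun p : unitInterval × U m => c * p.2.1 :=
        continuous_const.mul (continuous_subtype_val.comp continuous_snd)
      exact (h1.smul h2).add continuous_const)
    (fun p => div_ne_zero (det_add_smul_mul_ne_zero h (hW p.2) (by
      rw [Complex.norm_real, Real.norm_of_nonneg p.1.2.1]; exact p.1.2.2)) hd)
    (fun W => by simp [H, hd])
  refine ⟨fun W => φ (1, W), hφc.comp (by fun_prop), fun W => ?_, fun W => ?_⟩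
  · let P : Polynomial ℂ := ((Polynomial.X : Polynomial ℂ) • (c * W.1).map Polynomial.C +
      d.map Polynomial.C).det
    have hP : ∀ z, P.eval z = (z • (c * W.1) + d).det := fun z => eval_det_X_smul_add _ _ z
    have hdeg : P.natDegree ≤ m := by
      simpa only [Fintype.card_fin] using Polynomial.natDegree_det_X_add_C_le (c * W.1) d
    refine (abs_arg_polynomial_le (p := P) (φ := fun s => φ (s, W))
      (fun z hz => by rw [hP]; exact det_add_smul_mul_ne_zero h (hW W) hz)
      (hφc.comp (by fun_prop)) (hφ0 W) (fun s => ?_)).trans ?_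
    · have := hφ (s, W)
      simp only [H] at this
      rw [hP, hP, zero_smul, zero_add]
      exact this
    · have : (P.natDegree : ℝ) ≤ m := by exact_mod_cast hdeg
      gcongr
  · have := hφ (1, W)
    simp only [H, Set.Icc.coe_one, Complex.ofReal_one, one_smul] at this
    rw [← this]
    field_simp

/-- The upper row of the Moebius form of a Hermitian symplectic matrix, up to a factor `2`. -/
def moebA (M : HSp m) : Matrix (Fin m) (Fin m) ℂ :=
  (M.1.1.toBlocks₁₁ + Complex.I • M.1.1.toBlocks₂₁) -
    Complex.I • (M.1.1.toBlocks₁₂ + Complex.I • M.1.1.toBlocks₂₂)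

def moebB (M : HSp m) : Matrix (Fin m) (Fin m) ℂ :=
  (M.1.1.toBlocks₁₁ + Complex.I • M.1.1.toBlocks₂₁) +
    Complex.I • (M.1.1.toBlocks₁₂ + Complex.I • M.1.1.toBlocks₂₂)

/-- The lower row of the Moebius form of a Hermitian symplectic matrix, up to a factor `2`. -/
def moebC (M : HSp m) : Matrix (Fin m) (Fin m) ℂ :=
  (M.1.1.toBlocks₁₁ - Complex.I • M.1.1.toBlocks₂₁) -
    Complex.I • (M.1.1.toBlocks₁₂ - Complex.I • M.1.1.toBlocks₂₂)

def moebD (M : HSp m) : Matrix (Fin m) (Fin m) ℂ :=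
  (M.1.1.toBlocks₁₁ - Complex.I • M.1.1.toBlocks₂₁) +
    Complex.I • (M.1.1.toBlocks₁₂ - Complex.I • M.1.1.toBlocks₂₂)

theorem coe_actU (M : HSp m) (W : U m) :
    (actU M W).1 = (moebA M * W.1 + moebB M) * (moebC M * W.1 + moebD M)⁻¹ := by
  change ((LagFrame.map M (frameOfU W)).X + Complex.I • (LagFrame.map M (frameOfU W)).Y) *
    ((LagFrame.map M (frameOfU W)).X - Complex.I • (LagFrame.map M (frameOfU W)).Y)⁻¹ = _
  refine congrArg₂ (fun P Q => P * Q⁻¹) ?_ ?_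
  · simp only [LagFrame.map, frameOfU, moebA, moebB, Matrix.mul_add, Matrix.mul_sub,
      Matrix.add_mul, Matrix.sub_mul, Matrix.smul_mul, Matrix.mul_smul, Matrix.mul_one]
    module
  · simp only [LagFrame.map, frameOfU, moebC, moebD, Matrix.mul_add, Matrix.mul_sub,
      Matrix.sub_mul, Matrix.smul_mul, Matrix.mul_smul, Matrix.mul_one]
    module

/-- The defining relation exhibits `-J M* J` as a left inverse of `M`, hence as a right inverse.
This form is needed because the domination of blocks concerns products `a aᴴ` within a row. -/
theorem HSp.mul_J_mul_conjTranspose (M : HSp m) : M.1.1 * J m * M.1.1ᴴ = J m := by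
  have hM : M.1.1ᴴ * J m * M.1.1 = J m := M.2
  have hJ : J m * J m = -1 := by
    rw [J, Matrix.fromBlocks_multiply, ← Matrix.fromBlocks_one, Matrix.fromBlocks_neg]
    simp
  have h1 : (-(J m) * M.1.1ᴴ * J m) * M.1.1 = 1 := by
    rw [Matrix.mul_assoc, Matrix.mul_assoc, ← Matrix.mul_assoc M.1.1ᴴ, hM, Matrix.neg_mul, hJ,
      neg_neg]
  have h2 := mul_eq_one_comm.1 h1
  calc M.1.1 * J m * M.1.1ᴴ = -(M.1.1 * J m * M.1.1ᴴ * (J m * J m)) := by rw [hJ]; simp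
    _ = (M.1.1 * (-(J m) * M.1.1ᴴ * J m)) * J m := by
      simp only [Matrix.neg_mul, Matrix.mul_neg, Matrix.mul_assoc]
    _ = J m := by rw [h2, Matrix.one_mul]

theorem HSp.blocks (M : HSp m) :
    M.1.1.toBlocks₁₁ * M.1.1.toBlocks₁₂ᴴ - M.1.1.toBlocks₁₂ * M.1.1.toBlocks₁₁ᴴ = 0 ∧
    M.1.1.toBlocks₁₁ * M.1.1.toBlocks₂₂ᴴ - M.1.1.toBlocks₁₂ * M.1.1.toBlocks₂₁ᴴ = 1 ∧
    M.1.1.toBlocks₂₁ * M.1.1.toBlocks₁₂ᴴ - M.1.1.toBlocks₂₂ * M.1.1.toBlocks₁₁ᴴ = -1 ∧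
    M.1.1.toBlocks₂₁ * M.1.1.toBlocks₂₂ᴴ - M.1.1.toBlocks₂₂ * M.1.1.toBlocks₂₁ᴴ = 0 := by
  have h := HSp.mul_J_mul_conjTranspose M
  rw [← Matrix.fromBlocks_toBlocks M.1.1, J, Matrix.fromBlocks_conjTranspose,
    Matrix.fromBlocks_multiply, Matrix.fromBlocks_multiply, Matrix.fromBlocks_inj] at h
  simp only [Matrix.mul_zero, Matrix.mul_neg, Matrix.mul_one, zero_add, add_zero, Matrix.neg_mul]
    at h
  simpa only [neg_add_eq_sub] using h

/-- The choices `k = i` and `k = -i` give the upper and the lower row. The constant is `4` because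
the blocks carry a factor `2`. -/
theorem moebius_row_mul_conjTranspose {P Q R S : Matrix (Fin m) (Fin m) ℂ} {k : ℂ}
    (hs : star k = -k) (hk : k * k = -1) (h1 : P * Qᴴ - Q * Pᴴ = 0) (h2 : P * Sᴴ - Q * Rᴴ = 1)
    (h3 : R * Qᴴ - S * Pᴴ = -1) (h4 : R * Sᴴ - S * Rᴴ = 0) :
    ((P + k • R) - k • (Q + k • S)) * ((P + k • R) - k • (Q + k • S))ᴴ =
      ((P + k • R) + k • (Q + k • S)) * ((P + k • R) + k • (Q + k • S))ᴴ + (4 : ℂ) • 1 := by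
  simp only [Matrix.conjTranspose_add, Matrix.conjTranspose_sub,
    Matrix.conjTranspose_smul, Matrix.mul_add, Matrix.add_mul, Matrix.mul_sub, Matrix.sub_mul,
    Matrix.smul_mul, Matrix.mul_smul, hs]
  linear_combination (norm := skip) (2 * k) • h1 + (2 : ℂ) • h2 - (2 : ℂ) • h3 + (2 * k) • h4
  match_scalars <;> grind

theorem moebA_mul_conjTranspose (M : HSp m) :
    moebA M * (moebA M)ᴴ = moebB M * (moebB M)ᴴ + (4 : ℂ) • 1 := by
  obtain ⟨h1, h2, h3, h4⟩ := HSp.blocks M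
  exact moebius_row_mul_conjTranspose (k := Complex.I) (by simp) (by simp) h1 h2 h3 h4

theorem moebD_mul_conjTranspose (M : HSp m) :
    moebD M * (moebD M)ᴴ = moebC M * (moebC M)ᴴ + (4 : ℂ) • 1 := by
  obtain ⟨h1, h2, h3, h4⟩ := HSp.blocks M
  have := moebius_row_mul_conjTranspose (k := -Complex.I) (by simp) (by simp) h1 h2 h3 h4
  simpa only [moebC, moebD, neg_smul, ← sub_eq_add_neg, sub_neg_eq_add] using this

theorem det_moebius_ne_zero (M : HSp m) (W : U m) : (moebC M * W.1 + moebD M).det ≠ 0 := by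
  have := det_add_smul_mul_ne_zero (moebD_mul_conjTranspose M)
    (Matrix.mem_unitaryGroup_iff.1 W.2) (z := 1) (by simp)
  rwa [one_smul] at this

theorem continuous_actU : Continuous fun p : HSp m × U m => actU p.1 p.2 := by
  refine continuous_induced_rng.2 ?_
  have hM : Continuous fun p : HSp m × U m => p.1.1.1 :=
    Units.continuous_val.comp (continuous_subtype_val.comp continuous_fst)
  have hW : Continuous fun p : HSp m × U m => p.2.1 := continuous_subtype_val.comp continuous_snd
  have h11 : Continuous fun p : HSp m × U m => p.1.1.1.toBlocks₁₁ := hM.matrix_submatrix _ _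
  have h12 : Continuous fun p : HSp m × U m => p.1.1.1.toBlocks₁₂ := hM.matrix_submatrix _ _
  have h21 : Continuous fun p : HSp m × U m => p.1.1.1.toBlocks₂₁ := hM.matrix_submatrix _ _
  have h22 : Continuous fun p : HSp m × U m => p.1.1.1.toBlocks₂₂ := hM.matrix_submatrix _ _
  have hA : Continuous fun p : HSp m × U m => moebA p.1 * p.2.1 + moebB p.1 := by
    unfold moebA moebB
    fun_prop
  have hC : Continuous fun p : HSp m × U m => moebC p.1 * p.2.1 + moebD p.1 := by
    unfold moebC moebD
    fun_prop
  have : Continuous fun p : HSp m × U m =>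
      (moebA p.1 * p.2.1 + moebB p.1) * (moebC p.1 * p.2.1 + moebD p.1)⁻¹ := by
    simp only [Matrix.inv_def, Ring.inverse_eq_inv']
    exact hA.mul ((hC.matrix_det.inv₀ fun p => det_moebius_ne_zero p.1 p.2).smul
      hC.matrix_adjugate)
  exact this.congr fun p => (coe_actU p.1 p.2).symm

theorem continuous_actU_comp {X : Type*} [TopologicalSpace X] {g : X → HSp m} {w : X → U m}
    (hg : Continuous g) (hw : Continuous w) : Continuous fun x => actU (g x) (w x) := by
  have h : Continuous fun x => (g x, w x) := hg.prodMk hw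
  exact Continuous.comp' (f := fun x => (g x, w x)) (g := fun p : HSp m × U m => actU p.1 p.2)
    continuous_actU h

theorem actU_one (W : U m) : actU 1 W = W := by
  have : ∀ Λ : Lag m, Lag.map 1 Λ = Λ := by
    intro Λ
    induction Λ using Quotient.inductionOn with
    | h L =>
      refine Quotient.sound ⟨1, ?_, ?_⟩ <;> ext i j <;>
        simp [LagFrame.map, Matrix.mul_apply, Matrix.toBlocks₁₁, Matrix.toBlocks₁₂,
          Matrix.toBlocks₂₁, Matrix.toBlocks₂₂, Matrix.one_apply]
  rw [actU, this, Equiv.apply_symm_apply]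

theorem actU_mul (M N : HSp m) (W : U m) : actU (M * N) W = actU M (actU N W) := by
  have : ∀ Λ : Lag m, Lag.map (M * N) Λ = Lag.map M (Lag.map N Λ) := by
    intro Λ
    induction Λ using Quotient.inductionOn with
    | h L =>
      refine Quotient.sound ⟨1, ?_⟩
      have h1 := fromRows_eq_mul (M * N).1.1 L.X L.Y
      have h2 := fromRows_eq_mul M.1.1 (LagFrame.map N L).X (LagFrame.map N L).Y
      have h3 := fromRows_eq_mul N.1.1 L.X L.Y
      have h4 : Matrix.fromRows (LagFrame.map (M * N) L).X (LagFrame.map (M * N) L).Y =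
          Matrix.fromRows (LagFrame.map M (LagFrame.map N L)).X
            (LagFrame.map M (LagFrame.map N L)).Y := by
        refine h1.trans (Eq.trans ?_ h2.symm)
        change (M.1.1 * N.1.1) * _ = M.1.1 * Matrix.fromRows _ _
        rw [Matrix.mul_assoc]
        congr 1
        exact h3.symm
      obtain ⟨h5, h6⟩ := (Matrix.fromRows_inj).eq_iff.1 h4
      simp [h5, h6]
  rw [actU, this, actU, actU, Equiv.symm_apply_apply]

/-- A continuous phase of `W ↦ det (M · W) / det W` oscillates by at most `2πm`, uniformly in
`M`. -/
theorem abs_phase_sub_le (M : HSp m) {φ : U m → ℝ} (hφ : Continuous φ)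
    (h : ∀ W, (actU M W).1.det = W.1.det * Complex.exp (φ W * Complex.I)) (V W : U m) :
    |φ V - φ W| ≤ 2 * Real.pi * m := by
  obtain ⟨α, hαc, hαb, hα⟩ := exists_arg_det (moebA_mul_conjTranspose M)
  obtain ⟨β, hβc, hβb, hβ⟩ := exists_arg_det (moebD_mul_conjTranspose M)
  have hd : (moebD M).det ≠ 0 := by
    have := det_add_smul_mul_ne_zero (moebD_mul_conjTranspose M) (W := 1) (by simp) (z := 0)
      (by simp)
    simpa using this
  -- After subtracting the arguments of numerator and denominator, only a positive factor and a
  -- constant independent of `W` remain.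
  have key : ∀ W : U m, ∃ r : ℝ, 0 ≤ r ∧
      Complex.exp (((φ W - α W⁻¹ + β W : ℝ) : ℂ) * Complex.I) =
        (moebA M).det / (moebD M).det * r := by
    intro W
    refine ⟨‖(moebB M * W⁻¹.1 + moebA M).det / (moebA M).det‖ /
      ‖(moebC M * W.1 + moebD M).det / (moebD M).det‖, by positivity, ?_⟩
    have hne := det_moebius_ne_zero M W
    have h1 : (actU M W).1.det * (moebC M * W.1 + moebD M).det =
        (moebA M * W.1 + moebB M).det := by
      rw [coe_actU, ← Matrix.det_mul, Matrix.mul_assoc, Matrix.nonsing_inv_mul _ hne.isUnit,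
        Matrix.mul_one]
    -- Factoring out `W` puts the dominant block `a` in the constant term, as `exists_arg_det`
    -- requires.
    have h2 : (moebA M * W.1 + moebB M).det = (moebB M * W⁻¹.1 + moebA M).det * W.1.det := by
      have h3 : W⁻¹.1 * W.1 = 1 := Matrix.mem_unitaryGroup_iff'.1 W.2
      rw [← Matrix.det_mul, Matrix.add_mul, Matrix.mul_assoc, h3, Matrix.mul_one, add_comm]
    have hr : ((‖(moebC M * W.1 + moebD M).det / (moebD M).det‖ : ℝ) : ℂ) ≠ 0 := by
      simp [hne, hd]
    rw [h2, h, hα W⁻¹, hβ W] at h1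
    have h4 : Complex.exp (φ W * Complex.I) * ((moebD M).det *
        (‖(moebC M * W.1 + moebD M).det / (moebD M).det‖ * Complex.exp (β W * Complex.I))) =
        (moebA M).det * (‖(moebB M * W⁻¹.1 + moebA M).det / (moebA M).det‖ *
          Complex.exp (α W⁻¹ * Complex.I)) := by
      refine mul_left_cancel₀ (det_ne_zero W) ?_
      linear_combination h1
    push_cast
    rw [add_mul, sub_mul, Complex.exp_add, Complex.exp_sub]
    have he := Complex.exp_ne_zero (α W⁻¹ * Complex.I)
    field_simp
    field_simp at h4 hr
    linear_combination h4
  -- The left side of `key` has modulus `1`, which determines `r`. Connectedness of `U m` makes the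
  -- combination constant, so the four bounds `mπ / 2` add up to `2πm`.
  have hconst := eq_of_exp_mul_I_eq (g := fun W => φ W - α W⁻¹ + β W)
    (c := (moebA M).det / (moebD M).det * (‖(moebA M).det / (moebD M).det‖⁻¹ : ℝ))
    ((hφ.sub (hαc.comp continuous_inv)).add hβc) (fun W => by
      obtain ⟨r, hr0, hr⟩ := key W
      rw [hr]
      have h5 := congrArg norm hr
      rw [Complex.norm_exp_ofReal_mul_I, norm_mul, Complex.norm_real, Real.norm_of_nonneg hr0] at h5
      rw [eq_inv_of_mul_eq_one_right h5.symm]) V W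
  have h1 := abs_le.1 (hαb V⁻¹)
  have h2 := abs_le.1 (hαb W⁻¹)
  have h3 := abs_le.1 (hβb V)
  have h4 := abs_le.1 (hβb W)
  rw [abs_le]
  constructor <;> linarith

end Moebius

/-! ### Iterates of the cocycle. -/

section Cocycle

variable {m : ℕ} {Θ : Type*} {T : Θ → Θ} {A : Θ → HSp m} {f : Θ × U m → ℝ}

/-- Lets a bound for single matrices, uniform over `HSp m`, control Birkhoff sums of every length.
-/
theorem exists_actU_eq_iterate (n : ℕ) (θ : Θ) :
    ∃ M : HSp m, ∀ W, ((cocycle T A)^[n] (θ, W)).2 = actU M W := by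
  induction n with
  | zero => exact ⟨1, fun W => (actU_one W).symm⟩
  | succ n ih =>
    obtain ⟨M, hM⟩ := ih
    refine ⟨A (T^[n] θ) * M, fun W => ?_⟩
    rw [Function.iterate_succ_apply', actU_mul, ← hM]
    change actU (A ((cocycle T A)^[n] (θ, W)).1) _ = _
    rw [iterate_fst (G := cocycle T A) (fun _ => rfl)]

theorem birkhoffAverage_add_int (p : Θ → ℤ) (n : ℕ) (θ : Θ) (W : U m) :
    birkhoffAverage ℝ (cocycle T A) (fun q => f q + p q.1) n (θ, W) =
      birkhoffAverage ℝ (cocycle T A) f n (θ, W) +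
        birkhoffAverage ℝ T (fun θ => (p θ : ℝ)) n θ := by
  simp only [birkhoffAverage, birkhoffSum, Finset.sum_add_distrib, smul_add,
    iterate_fst (G := cocycle T A) (fun _ => rfl)]

end Cocycle

/-! ### Phases of the cocycle and their relation to lifts. -/

section Lifts

variable {m : ℕ} {Θ : Type*} [TopologicalSpace Θ] {T : Θ → Θ} {A : Θ → HSp m}

/-- `f` is a continuous phase of the fibre maps of the cocycle: it satisfies
`det (A(θ) · W) = exp (2πi f(θ, W)) det W`. -/
def IsPhase (A : Θ → HSp m) (f : Θ × U m → ℝ) : Prop :=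
  Continuous f ∧ ∀ θ W, (actU (A θ) W).1.det =
    W.1.det * Complex.exp (2 * Real.pi * Complex.I * f (θ, W))

theorem exists_isPhase {A : C(Θ, HSp m)} (hA : A.Homotopic (ContinuousMap.const Θ 1)) :
    ∃ f, IsPhase A f := by
  obtain ⟨G⟩ := hA.symm
  have hc : Continuous fun p : unitInterval × (Θ × U m) => actU (G (p.1, p.2.1)) p.2.2 :=
    continuous_actU_comp (by fun_prop) (by fun_prop)
  obtain ⟨φ, hφ, -, h⟩ := exists_arg_lift
    (H := fun p : unitInterval × (Θ × U m) =>
      (actU (G (p.1, p.2.1)) p.2.2).1.det * star p.2.2.1.det)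
    ((continuous_det.comp hc).mul (continuous_det.comp (by fun_prop)).star)
    (fun p => mul_ne_zero (det_ne_zero _) (star_ne_zero.2 (det_ne_zero _)))
    (fun q => by
      have : G (0, q.1) = 1 := by simp
      rw [this, actU_one, det_mul_star_det])
  refine ⟨fun q => φ (1, q) / (2 * Real.pi), (hφ.comp (by fun_prop)).div_const _,
    fun θ W => ?_⟩
  have h1 := h (1, θ, W)
  have h2 : G (1, θ) = A θ := by simp
  rw [norm_mul, norm_star, norm_det, norm_det, mul_one, Complex.ofReal_one, one_mul] at h1
  dsimp only at h1
  rw [h2] at h1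
  have h3 : (2 * Real.pi * Complex.I * (φ (1, θ, W) / (2 * Real.pi) : ℝ) : ℂ) =
      φ (1, θ, W) * Complex.I := by
    have : (Real.pi : ℂ) ≠ 0 := by exact_mod_cast Real.pi_ne_zero
    push_cast
    field_simp
  rw [h3, ← h1, mul_comm, mul_assoc, star_det_mul_det, mul_one]

theorem det_cover (p : ℝ × SU m) :
    (cover p).1.det = Complex.exp (2 * Real.pi * Complex.I * (m * p.1 : ℝ)) := by
  change (Complex.exp (2 * Real.pi * Complex.I * p.1) • p.2.1).det = _
  rw [Matrix.det_smul, (Matrix.mem_specialUnitaryGroup_iff.1 p.2.2).2, mul_one, Fintype.card_fin,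
    ← Complex.exp_nat_mul]
  congr 1
  push_cast
  ring

theorem continuous_cover : Continuous (cover (m := m)) := by
  refine Continuous.subtype_mk ?_ _
  have h1 : Continuous fun p : ℝ × SU m => Complex.exp (2 * Real.pi * Complex.I * p.1) := by
    fun_prop
  exact h1.smul (continuous_subtype_val.comp continuous_snd)

/-- Determinants dictate the real coordinate up to `1 / m` times an integer: `m y = m x + f`.
Dividing `A(θ) · W` by `exp (2πi y)` then leaves a matrix of determinant `1`. -/
theorem IsPhase.exists_isLift (hm : 1 ≤ m) (hT : Continuous T) (hA : Continuous A)
    {f : Θ × U m → ℝ} (hf : IsPhase A f) : ∃ F, IsLift T A F := by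
  have hm0 : (m : ℂ) ≠ 0 := by exact_mod_cast (by omega : m ≠ 0)
  let y : Θ × ℝ × SU m → ℝ := fun p => p.2.1 + f (p.1, cover p.2) / m
  let W : Θ × ℝ × SU m → U m := fun p => actU (A p.1) (cover p.2)
  let V : Θ × ℝ × SU m → U m := fun p => scalarU m (-(2 * Real.pi * y p)) * W p
  have hVval : ∀ p, (V p).1 = Complex.exp (-(2 * Real.pi * Complex.I * y p)) • (W p).1 := by
    intro p
    change (Complex.exp ((-(2 * Real.pi * y p) : ℝ) * Complex.I) • 1) * (W p).1 = _
    rw [Matrix.smul_mul, Matrix.one_mul]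
    congr 2
    push_cast
    ring
  have hV : ∀ p, (V p).1 ∈ Matrix.specialUnitaryGroup (Fin m) ℂ := by
    intro p
    refine Matrix.mem_specialUnitaryGroup_iff.2 ⟨(V p).2, ?_⟩
    rw [hVval, Matrix.det_smul, hf.2, det_cover, Fintype.card_fin, ← Complex.exp_nat_mul,
      ← Complex.exp_add, ← Complex.exp_add, ← Complex.exp_zero]
    congr 1
    simp only [y]
    push_cast
    field_simp
    ring
  have hcov : Continuous fun p : Θ × ℝ × SU m => cover p.2 := continuous_cover.comp continuous_snd
  have hy : Continuous y :=
    (continuous_fst.comp continuous_snd).add ((hf.1.comp (continuous_fst.prodMk hcov)).div_const _)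
  have hW : Continuous W := continuous_actU_comp (hA.comp continuous_fst) hcov
  have hVc : Continuous V :=
    (continuous_scalarU.comp (continuous_const.mul hy).neg).mul hW
  refine ⟨fun p => (T p.1, y p, ⟨(V p).1, hV p⟩), ?_, fun p => ?_⟩
  · exact (hT.comp continuous_fst).prodMk
      (hy.prodMk ((continuous_subtype_val.comp hVc).subtype_mk _))
  · refine Prod.ext rfl (Subtype.ext ?_)
    change Complex.exp (2 * Real.pi * Complex.I * y p) • (V p).1 = (W p).1
    rw [hVval, smul_smul, ← Complex.exp_add, add_neg_cancel, Complex.exp_zero, one_smul]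

/-- Both sides are continuous arguments of the same determinant ratio, hence differ by an integer,
which is constant along the connected fibre `ℝ × SU m`. -/
theorem IsLift.exists_eq_phase_add (hm : 1 ≤ m) {f : Θ × U m → ℝ} (hf : IsPhase A f)
    {F : Θ × ℝ × SU m → Θ × ℝ × SU m} (hF : IsLift T A F) :
    ∃ k : C(Θ, ℤ), ∀ θ x S, m * ((F (θ, x, S)).2.1 - x) = f (θ, cover (x, S)) + k θ := by
  have : NeZero m := ⟨by omega⟩
  have := preconnectedSpace_SU (m := m)
  obtain ⟨K, hK⟩ := exists_continuousMap_int
    (g := fun p : Θ × ℝ × SU m => m * ((F p).2.1 - p.2.1) - f (p.1, cover p.2))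
    (by
      have h1 := hF.1
      have h2 := hf.1
      have h3 := continuous_cover (m := m)
      fun_prop)
    (fun p => by
      have h1 : cover (F p).2 = actU (A p.1) (cover p.2) := congrArg Prod.snd (hF.2 p)
      have h2 : (cover (F p).2).1.det = _ := congrArg (fun W : U m => W.1.det) h1
      rw [hf.2, det_cover, det_cover, ← Complex.exp_add] at h2
      have h3 : (2 * Real.pi * Complex.I *
          ((m * ((F p).2.1 - p.2.1) - f (p.1, cover p.2) : ℝ) : ℂ)) =
          2 * Real.pi * Complex.I * (m * (F p).2.1 : ℝ) -
            (2 * Real.pi * Complex.I * (m * p.2.1 : ℝ) +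
              2 * Real.pi * Complex.I * f (p.1, cover p.2)) := by
        push_cast
        ring
      rw [h3, Complex.exp_sub, h2, div_self (Complex.exp_ne_zero _)])
  refine ⟨K.comp ⟨fun θ => (θ, 0, 1), by fun_prop⟩, fun θ x S => ?_⟩
  have h1 : K (θ, x, S) = K (θ, 0, 1) :=
    PreconnectedSpace.constant (α := ℝ × SU m) inferInstance (f := fun q => K (θ, q))
      (K.continuous.comp (by fun_prop)) (x := (x, S)) (y := (0, 1))
  have h2 := hK (θ, x, S)
  rw [h1] at h2
  simp only [ContinuousMap.comp_apply, ContinuousMap.coe_mk]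
  linarith

theorem increment_eq_of_forall {f : Θ × U m → ℝ} {k : C(Θ, ℤ)}
    {F : Θ × ℝ × SU m → Θ × ℝ × SU m}
    (h : ∀ θ x S, m * ((F (θ, x, S)).2.1 - x) = f (θ, cover (x, S)) + k θ) (θ : Θ) (W : U m) :
    increment F (θ, W) = f (θ, W) + k θ := by
  have h1 := h θ (Function.surjInv (cover_surjective m) W).1
    (Function.surjInv (cover_surjective m) W).2
  rw [Prod.mk.eta, Function.surjInv_eq (cover_surjective m) W] at h1
  exact h1

theorem IsPhase.add_int {f : Θ × U m → ℝ} (hf : IsPhase A f) (k : C(Θ, ℤ)) :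
    IsPhase A fun q => f q + k q.1 := by
  refine ⟨hf.1.add (Int.isClosedEmbedding_coe_real.continuous.comp
    (k.continuous.comp continuous_fst)), fun θ W => ?_⟩
  have h1 : Complex.exp (2 * Real.pi * Complex.I * (k θ : ℂ)) = 1 :=
    Complex.exp_eq_one_iff.2 ⟨k θ, by ring⟩
  rw [hf.2]
  push_cast
  rw [mul_add, Complex.exp_add, h1, mul_one]

theorem IsPhase.det_iterate {f : Θ × U m → ℝ} (hf : IsPhase A f) (n : ℕ) (θ : Θ) (W : U m) :
    ((cocycle T A)^[n] (θ, W)).2.1.det = W.1.det *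
      Complex.exp (2 * Real.pi * Complex.I * birkhoffSum (cocycle T A) f n (θ, W)) := by
  induction n with
  | zero => simp
  | succ n ih =>
    rw [Function.iterate_succ_apply', birkhoffSum_succ]
    change (actU (A _) ((cocycle T A)^[n] (θ, W)).2).1.det = _
    rw [hf.2, ih, mul_assoc, ← Complex.exp_add]
    push_cast
    rw [mul_add]

theorem continuous_cocycle (hT : Continuous T) (hA : Continuous A) : Continuous (cocycle T A) :=
  (hT.comp continuous_fst).prodMk
    (continuous_actU_comp (hA.comp continuous_fst) continuous_snd)

theorem IsPhase.continuous_birkhoffSum (hT : Continuous T) (hA : Continuous A)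
    {f : Θ × U m → ℝ} (hf : IsPhase A f) (n : ℕ) :
    Continuous (birkhoffSum (cocycle T A) f n) :=
  continuous_finsetSum _ fun i _ => hf.1.comp ((continuous_cocycle hT hA).iterate i)

/-- The `n`-th Birkhoff sum, multiplied by `2π`, is a continuous phase of the single matrix
describing the `n`-th iterate on the fibre, so `abs_phase_sub_le` applies. -/
theorem IsPhase.abs_birkhoffSum_sub_le (hT : Continuous T) (hA : Continuous A)
    {f : Θ × U m → ℝ} (hf : IsPhase A f) (n : ℕ) (θ : Θ) (V W : U m) :
    |birkhoffSum (cocycle T A) f n (θ, V) - birkhoffSum (cocycle T A) f n (θ, W)| ≤ m := by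
  obtain ⟨M, hM⟩ := exists_actU_eq_iterate (T := T) (A := A) n θ
  have hc := hf.continuous_birkhoffSum hT hA n
  have h1 := abs_phase_sub_le M
    (φ := fun W => 2 * Real.pi * birkhoffSum (cocycle T A) f n (θ, W)) (by fun_prop)
    (fun W => by
      rw [← hM, hf.det_iterate]
      congr 2
      push_cast
      ring) V W
  have hp : 0 < 2 * Real.pi := by positivity
  rw [← mul_sub, abs_mul, abs_of_pos hp] at h1
  exact le_of_mul_le_mul_left h1 hp

theorem IsPhase.exists_abs_le [CompactSpace Θ] (hf : IsPhase A f) : ∃ B, ∀ q, |f q| ≤ B := by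
  obtain ⟨B, hB⟩ := isCompact_univ.exists_bound_of_continuousOn hf.1.continuousOn
  exact ⟨B, fun q => hB q trivial⟩

end Lifts

/-! ### Limits and integrals of a phase. -/

section RotationNumber

variable {m : ℕ} {Θ : Type*} [MetricSpace Θ] [CompactSpace Θ] [MeasurableSpace Θ] [BorelSpace Θ]
  {T : Θ → Θ} {A : Θ → HSp m} {f : Θ × U m → ℝ}

theorem IsPhase.integrable (hf : IsPhase A f) (ν : Measure (Θ × U m)) [IsProbabilityMeasure ν] :
    Integrable f ν := by
  obtain ⟨B, hB⟩ := hf.exists_abs_le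
  exact .of_bound hf.1.measurable.aestronglyMeasurable B (Eventually.of_forall hB)

theorem IsPhase.exists_ae_tendsto (hTc : Continuous T) (hA : Continuous A) (hf : IsPhase A f)
    {μ : Measure Θ} [IsProbabilityMeasure μ] (hT : Ergodic T μ) :
    ∃ ρ : ℝ, ∀ᵐ θ ∂μ, ∀ W : U m,
      Tendsto (fun n => birkhoffAverage ℝ (cocycle T A) f n (θ, W)) atTop (𝓝 ρ) := by
  obtain ⟨B, hB⟩ := hf.exists_abs_le
  exact exists_ae_tendsto_birkhoffAverage_skew hT (fun _ => rfl) hB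
    (hf.abs_birkhoffSum_sub_le hTc hA) fun n W =>
      ((hf.continuous_birkhoffSum hTc hA n).comp (by fun_prop)).measurable

theorem IsPhase.integral_eq (hf : IsPhase A f) {μ : Measure Θ} {ρ : ℝ}
    (hρ : ∀ᵐ θ ∂μ, ∀ W : U m,
      Tendsto (fun n => birkhoffAverage ℝ (cocycle T A) f n (θ, W)) atTop (𝓝 ρ))
    {ν : Measure (Θ × U m)} [IsProbabilityMeasure ν] (hν : MeasurePreserving (cocycle T A) ν ν)
    (hνμ : ν.map Prod.fst = μ) : ∫ q, f q ∂ν = ρ := by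
  obtain ⟨B, hB⟩ := hf.exists_abs_le
  refine integral_eq_of_ae_tendsto_birkhoffAverage hν (hf.integrable ν) hB ?_
  rw [← hνμ] at hρ
  filter_upwards [ae_of_ae_map measurable_fst.aemeasurable hρ] with q hq
  exact hq q.2

end RotationNumber

end FiberedRotation

/-! ### The fibered rotation number of the cocycle. -/

open FiberedRotation
theorem lemma3p4 {Θ : Type*} [MetricSpace Θ] [CompactSpace Θ] [MeasurableSpace Θ] [BorelSpace Θ]
    (T : Θ ≃ₜ Θ) (μ : Measure Θ) [IsProbabilityMeasure μ]
    (hμ : Ergodic T μ) (m : ℕ) (hm : 1 ≤ m) (A : C(Θ, HSp m))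
    (hA : A.Homotopic (ContinuousMap.const Θ 1)) :
    (∃ F, IsLift T A F) ∧
    (∀ F, IsLift T A F →
      Continuous (increment F) ∧
      (∀ θ x S, increment F (θ, cover (x, S)) = m * ((F (θ, x, S)).2.1 - x)) ∧
      ∀ (θ : Θ) (W : U m) (ρ : ℝ),
        Tendsto (fun n => birkhoffAverage ℝ (cocycle T A) (increment F) n (θ, W)) atTop (𝓝 ρ) →
        ∀ W' : U m,
          Tendsto (fun n => birkhoffAverage ℝ (cocycle T A) (increment F) n (θ, W')) atTop
            (𝓝 ρ)) ∧
    (∀ F F', IsLift T A F → IsLift T A F' →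
      ∃ p : C(Θ, ℤ), ∀ θ W, increment F (θ, W) = increment F' (θ, W) + p θ) ∧
    ∃! r : ℝ ⧸ integerMeans μ, ∀ F, IsLift T A F →
      ∃ ρ : ℝ, (ρ : ℝ ⧸ integerMeans μ) = r ∧
        (∀ᵐ θ ∂μ, ∀ W : U m,
          Tendsto (fun n => birkhoffAverage ℝ (cocycle T A) (increment F) n (θ, W)) atTop
            (𝓝 ρ)) ∧
        ∀ ν : Measure (Θ × U m), IsProbabilityMeasure ν →
          MeasurePreserving (cocycle T A) ν ν → ν.map Prod.fst = μ →
          Integrable (increment F) ν ∧ ∫ q, increment F q ∂ν = ρ := by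
  have hTc : Continuous T := T.continuous
  have hAc : Continuous A := A.continuous
  obtain ⟨f, hf⟩ := exists_isPhase hA
  have hinc : ∀ F, IsLift T A F → ∃ k : C(Θ, ℤ),
      (increment F = fun q => f q + k q.1) ∧
        ∀ θ x S, increment F (θ, cover (x, S)) = m * ((F (θ, x, S)).2.1 - x) := by
    intro F hF
    obtain ⟨k, hk⟩ := hF.exists_eq_phase_add hm hf
    have h1 := increment_eq_of_forall hk
    exact ⟨k, funext fun q => h1 q.1 q.2, fun θ x S => by rw [hk, h1]⟩
  have hphase : ∀ F, IsLift T A F → IsPhase A (increment F) := by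
    intro F hF
    obtain ⟨k, hk, -⟩ := hinc F hF
    exact hk ▸ hf.add_int k
  obtain ⟨F₀, hF₀⟩ := hf.exists_isLift hm hTc hAc
  refine ⟨⟨F₀, hF₀⟩, fun F hF => ⟨(hphase F hF).1, (hinc F hF).choose_spec.2, ?_⟩, ?_, ?_⟩
  · intro θ W ρ h W'
    exact tendsto_birkhoffAverage_of_fibre_osc ((hphase F hF).abs_birkhoffSum_sub_le hTc hAc) h
  · intro F F' hF hF'
    obtain ⟨k, hk, -⟩ := hinc F hF
    obtain ⟨k', hk', -⟩ := hinc F' hF'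
    refine ⟨k - k', fun θ W => ?_⟩
    simp [hk, hk']
  · obtain ⟨ρ, hρ⟩ := hf.exists_ae_tendsto hTc hAc hμ
    refine ⟨(ρ : ℝ ⧸ integerMeans μ), fun F hF => ?_, fun r hr => ?_⟩
    · obtain ⟨k, hk, -⟩ := hinc F hF
      have hlim : ∀ᵐ θ ∂μ, ∀ W : U m,
          Tendsto (fun n => birkhoffAverage ℝ (cocycle T A) (increment F) n (θ, W)) atTop
            (𝓝 (ρ + ∫ θ, (k θ : ℝ) ∂μ)) := by
        have hkm : Measurable fun θ => (k θ : ℝ) :=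
          (Int.isClosedEmbedding_coe_real.continuous.comp k.continuous).measurable
        filter_upwards [hρ, ae_tendsto_birkhoffAverage hμ hkm (integrable_intCast μ k)]
          with θ h1 h2 W
        rw [hk]
        simp only [birkhoffAverage_add_int]
        exact (h1 W).add h2
      refine ⟨_, ?_, hlim, fun ν hν hinv hproj =>
        ⟨(hphase F hF).integrable ν, (hphase F hF).integral_eq hlim hinv hproj⟩⟩
      -- The representative for this lift is `ρ + ∫ k dμ`.
      refine (QuotientAddGroup.eq.2 ?_).symm
      rw [neg_add_cancel_left]
      exact ⟨k, rfl⟩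
    -- The existing lift `F₀` pins down the class: its limit for `r` must agree with `ρ + ∫ k dμ` at
    -- one good `θ`, tested at `W = 1`.
    · obtain ⟨k, hk, -⟩ := hinc F₀ hF₀
      obtain ⟨ρ', rfl, hρ', -⟩ := hr F₀ hF₀
      have hkm : Measurable fun θ => (k θ : ℝ) :=
        (Int.isClosedEmbedding_coe_real.continuous.comp k.continuous).measurable
      obtain ⟨θ, h1, h2, h3⟩ := (hρ.and (hρ'.and
        (ae_tendsto_birkhoffAverage hμ hkm (integrable_intCast μ k)))).exists
      have h4 := h2 1
      rw [hk] at h4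
      simp only [birkhoffAverage_add_int] at h4
      have h5 := tendsto_nhds_unique h4 ((h1 1).add h3)
      refine (QuotientAddGroup.eq.2 ?_).symm
      rw [h5, neg_add_cancel_left]
      exact ⟨k, rfl⟩
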